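/- Let $G$ be a discrete group acting properly discontinuously by homeomorphisms on a paracompact Hausdorff space $X$, and let $I$ be a set on which $G$ acts. Let $\mathscr A=\{A_i\}_{i\in I}$ be a locally finite covering of $X$ by closed sets and $\mathscr U=\{U_i\}_{i\in I}$ a covering of $X$ by open sets, both $G$-invariant: $g(A_i)=A_{gi}$ and $g(U_i)=U_{gi}$ for all $g\in G$, $i\in I$. For finite nonempty $\sigma\subset I$ put $A_\sigma=\bigcap_{i\in\sigma}A_i$ and $U_\sigma=\bigcap_{i\in\sigma}U_i$, and let $G_\sigma=\{g\in G: g(A_\sigma)=A_\sigma\}$. The nerve $\mathcal N(\mathscr A)$ is the simplicial complex whose simplices are the finite nonempty $\sigma\subset I$ with $A_\sigma\neq\emptyset$; its geometric realization carries the weak topology and the $G$-action that is linear on simplices and induced by the action of $G$ on $I$. Suppose that $\mathscr A$ is an equivalent refinement of $\mathscr U$: for all finite nonempty $\sigma\subset I$ one has $A_\sigma\ne\emptyset$ if and only if $U_\sigma\neq\emptyset$, and, for every simplex $\sigma$ of $\mathcal N(\mathscr A)$, $A_\sigma\subset U_\sigma$, the set $U_\sigma$ is $G_\sigma$-invariant,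 and there is a continuous map $H:U_\sigma\times[0,1]\to U_\sigma$ with $H(gx,t)=gH(x,t)$, $H(x,0)=x$, $H(x,1)\in A_\sigma$ and $H(a,t)=a$ for all $g\in G_\sigma$, $x\in U_\sigma$, $a\in A_\sigma$, $t\in[0,1]$. Suppose also that, for every simplex $\sigma$ of $\mathcal N(\mathscr A)$, the group $G_\sigma$ is finite and $A_\sigma$ is $G_\sigma$-contractible, i.e. $G_\sigma$-homotopy equivalent to a point. Then $X$ is $G$-homotopy equivalent to $\mathcal N(\mathscr A)$: there are $G$-equivariant continuous maps $f:X\to\mathcal N(\mathscr A)$ and $h:\mathcal N(\mathscr A)\to X$ such that $h\circ f$ and $f\circ h$ are homotopic to the identity maps through homotopies $H$ with $H(gx,t)=gH(x,t)$ for all $g\in G$. -/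

import Mathlib

open scoped Pointwise

namespace EquivariantNerve

universe u v w

/-! ### Equivariant homotopy -/

section Homotopy

variable (G : Type u) {X : Type v} {Y : Type w} [TopologicalSpace X] [TopologicalSpace Y]
  [SMul G X] [SMul G Y]

/-- Two maps are `G`-homotopic if there is a homotopy `H` between them with
`H (g x, t) = g H (x, t)`. -/
def GHomotopic (f₀ f₁ : C(X, Y)) : Prop :=
  ∃ H : ContinuousMap.Homotopy f₀ f₁, ∀ (g : G) (t : unitInterval) (x : X), H (t, g • x) = g • H (t, x)

variable (X Y) in
/-- `G`-homotopy equivalence, through `G`-equivariant continuous maps. -/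
def GHomotopyEquivalent : Prop :=
  ∃ (f : C(X, Y)) (h : C(Y, X)),
    (∀ (g : G) (x : X), f (g • x) = g • f x) ∧
    (∀ (g : G) (y : Y), h (g • y) = g • h y) ∧
    GHomotopic G (h.comp f) (ContinuousMap.id X) ∧
    GHomotopic G (f.comp h) (ContinuousMap.id Y)

variable (X) in
/-- `X` is `G`-contractible if it is `G`-homotopy equivalent to a point. -/
def GContractible : Prop :=
  GHomotopyEquivalent G X PUnit.{1}

/-- The subset `A` is a `G`-deformation retract of `X` (the homotopy fixes `A` pointwise). -/
def IsGDeformationRetract (A : Set X) : Prop :=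
  ∃ H : C(unitInterval × X, X),
    (∀ (g : G) (t : unitInterval) (x : X), H (t, g • x) = g • H (t, x)) ∧
    (∀ x, H (0, x) = x) ∧ (∀ x, H (1, x) ∈ A) ∧ (∀ (t : unitInterval), ∀ a ∈ A, H (t, a) = a)

end Homotopy

/-! ### Geometric realization of a simplicial complex -/

section Realization

variable {V : Type u}

/-- Points of the geometric realization, in barycentric coordinates: nonnegative functions on the
vertices that vanish off some face and whose values sum to `1`. -/
def Realization (K : PreAbstractSimplicialComplex V) : Type u :=
  {p : V → ℝ // (∀ v, 0 ≤ p v) ∧ ∃ σ ∈ K.faces, (∀ v ∉ σ, p v = 0) ∧ ∑ v ∈ σ, p v = 1}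

/-- The closed simplex of the realization spanned by `σ`. -/
def closedSimplex (K : PreAbstractSimplicialComplex V) (σ : Finset V) : Set (Realization K) :=
  {p | ∀ v ∉ σ, p.1 v = 0}

/-- The weak topology: each closed simplex carries the Euclidean topology given by the barycentric
coordinates, and the realization carries the finest topology for which the inclusions of the closed
simplices are continuous. -/
instance (K : PreAbstractSimplicialComplex V) : TopologicalSpace (Realization K) :=
  ⨆ σ : K.faces, TopologicalSpace.coinduced
    (Subtype.val : closedSimplex K σ.1 → Realization K)
    (TopologicalSpace.induced (fun p => p.1.1) (Pi.topologicalSpace : TopologicalSpace (V → ℝ)))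

end Realization

/-! ### Invariant coverings and their nerves -/

section Cover

/-- A covering `(A i)` of `X` indexed by a set `ι` with `G`-action such that `g (A i) = A (g i)`. -/
structure InvariantCover (G : Type u) (ι : Type v) (X : Type w) [Group G] [MulAction G ι]
    [MulAction G X] where
  /-- the members of the covering -/
  sets : ι → Set X
  iUnion_sets : ⋃ i, sets i = Set.univ
  smul_sets : ∀ (g : G) (i : ι), g • sets i = sets (g • i)

variable {G : Type u} {ι : Type v} {X : Type w}

/-- `A_σ`, the intersection of the `A i` for `i ∈ σ`. -/
def inter (A : ι → Set X) (σ : Finset ι) : Set X := ⋂ i ∈ σ, A i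

/-- The nerve of a family of sets: its simplices are the nonempty finite `σ` with `A_σ ≠ ∅`. -/
def nerve (A : ι → Set X) : PreAbstractSimplicialComplex ι where
  faces := {σ | σ.Nonempty ∧ (inter A σ).Nonempty}
  isRelLowerSet_faces := fun _ hσ =>
    ⟨hσ.1, fun _ hτσ hτ => ⟨hτ, hσ.2.mono (Set.biInter_mono hτσ fun _ _ => le_rfl)⟩⟩

variable [Group G] [MulAction G ι] [MulAction G X]

/-- `G_σ`, the subgroup of the elements of `G` that map `A_σ` onto itself. -/
def stab (G : Type u) [Group G] [MulAction G X] (A : ι → Set X) (σ : Finset ι) : Subgroup G :=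
  MulAction.stabilizer G (inter A σ)

/-- `A_σ` as a space with an action of `G_σ`. -/
def interSub (G : Type u) [Group G] [MulAction G X] (A : ι → Set X) (σ : Finset ι) :
    SubMulAction (stab G A σ) X where
  carrier := inter A σ
  smul_mem' := fun g x hx => by
    have h : (g : G) • inter A σ = inter A σ := g.2
    have h2 := Set.smul_mem_smul_set (a := (g : G)) hx
    rw [h] at h2
    exact h2

theorem InvariantCover.map_mem_nerve (A : InvariantCover G ι X) (g : G) {σ : Finset ι}
    (hσ : σ ∈ (nerve A.sets).faces) :
    σ.map (MulAction.toPerm g).toEmbedding ∈ (nerve A.sets).faces := by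
  obtain ⟨h1, x, hx⟩ := hσ
  refine ⟨h1.map, g • x, ?_⟩
  simp only [inter, Set.mem_iInter, Finset.mem_map] at hx ⊢
  rintro _ ⟨i, hi, rfl⟩
  have := Set.smul_mem_smul_set (a := g) (hx i hi)
  rwa [A.smul_sets] at this

/-- The action of `G` on the realization of the nerve, linear on each simplex, that maps the vertex
`i` to the vertex `g i`. -/
instance (A : InvariantCover G ι X) : MulAction G (Realization (nerve A.sets)) where
  smul g p := ⟨fun i => p.1 (g⁻¹ • i), fun i => p.2.1 _, by
    obtain ⟨σ, hσ, h0, h1⟩ := p.2.2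
    refine ⟨_, A.map_mem_nerve g hσ, fun i hi => h0 _ fun h => hi ?_, ?_⟩
    · exact Finset.mem_map.2 ⟨_, h, by simp⟩
    · simpa using h1⟩
  one_smul p := Subtype.ext <| funext fun i => congrArg p.1 (by simp)
  mul_smul g h p := Subtype.ext <| funext fun i => congrArg p.1 (by simp [mul_smul])

/-- `A` is an equivalent refinement of `B`: for every simplex `σ`, the set `A_σ` is a
`G_σ`-deformation retract of `B_σ` (in particular `A_σ ⊆ B_σ` and `G_σ` acts on `B_σ`), and the
correspondence `A_σ ↦ B_σ` is an isomorphism of nerves, i.e. the two nerves have the same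
simplices. -/
def InvariantCover.IsEquivalentRefinement [TopologicalSpace X] (A B : InvariantCover G ι X) :
    Prop :=
  (∀ σ ∈ (nerve A.sets).faces, ∃ S : SubMulAction (stab G A.sets σ) X,
    (S : Set X) = inter B.sets σ ∧ inter A.sets σ ⊆ (S : Set X) ∧
    IsGDeformationRetract (stab G A.sets σ) (Subtype.val ⁻¹' inter A.sets σ : Set S)) ∧
  nerve A.sets = nerve B.sets

end Cover

end EquivariantNerve

/-! # The equivariant nerve theorem -/

namespace EquivariantNerve

open Function Topology

local notation "I" => unitInterval

/-! ### Equivariant homotopies -/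

section Homotopy

variable {G X Y : Type*} [TopologicalSpace X] [TopologicalSpace Y] [SMul G X] [SMul G Y]

/-! The map `f` normalizes an invariant family of bump functions subordinate to `𝒰`
(`exists_equivariant_bump`); finite stabilizers of the indices of nonempty members allow averaging
and an invariant locally finite thickening of `𝒜`.

For the map back, retracting `U_τ` to `A_τ` and then contracting `A_τ` gives contractions `c τ` of
`U_τ`, compatible with `G` (`exists_equivariant_contraction`). Weights `p` on the vertices drive a
flow on `X`. The cuts of `p`, the finite sets whose weights strictly exceed all others, form a
chain. Apply `c τ` for the nonempty cuts, largest first, at a time that tends to `1`, where `c τ` is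
the identity, as `τ` ceases to be a cut; hence the flow is continuous (`continuous_cutFlow`). At
parameter `0` a cut with a wide gap is contracted completely, so the endpoint forgets the start and
defines `h p` (`nerveMap_eq`). At parameter `1` nothing moves.

Started at `x` with weights from `f x`, the flow is a homotopy from `h ∘ f` to the identity. For `f
∘ h`, the weights are capped so that `h p` lies in `U_i` whenever `i` has at least half the maximal
weight (`nerveMap_mem`). A map `θ` keeps only such vertices. The supports of `f (h p)` and `θ p`
span a simplex, and so do those of `θ p` and `p`; straight-line homotopies finish. -/

theorem GHomotopic.trans {f₀ f₁ f₂ : C(X, Y)} (h₁ : GHomotopic G f₀ f₁)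
    (h₂ : GHomotopic G f₁ f₂) : GHomotopic G f₀ f₂ := by
  obtain ⟨H₁, h₁⟩ := h₁
  obtain ⟨H₂, h₂⟩ := h₂
  refine ⟨H₁.trans H₂, fun g t x => ?_⟩
  simp only [ContinuousMap.Homotopy.trans_apply]
  split_ifs
  · exact h₁ _ _ _
  · exact h₂ _ _ _

theorem GHomotopic.symm {f₀ f₁ : C(X, Y)} (h₁ : GHomotopic G f₀ f₁) : GHomotopic G f₁ f₀ := by
  obtain ⟨H₁, h₁⟩ := h₁
  exact ⟨H₁.symm, fun g t x => by simpa using h₁ g (unitInterval.symm t) x⟩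

end Homotopy

/-! ### The weak topology on the realization -/

section Realization

variable {V : Type*} {K : PreAbstractSimplicialComplex V}

/-- The closed simplex spanned by `σ`, with the Euclidean topology. -/
def EuclideanSimplex (K : PreAbstractSimplicialComplex V) (σ : Finset V) : Type _ :=
  closedSimplex K σ

instance (σ : Finset V) : TopologicalSpace (EuclideanSimplex K σ) :=
  TopologicalSpace.induced (fun p => p.1.1) (Pi.topologicalSpace : TopologicalSpace (V → ℝ))

/-- The inclusion of a closed simplex into the realization. -/
def EuclideanSimplex.incl {σ : Finset V} (p : EuclideanSimplex K σ) : Realization K := p.1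

theorem EuclideanSimplex.eq_zero {σ : Finset V} (p : EuclideanSimplex K σ) {v : V} (hv : v ∉ σ) :
    p.incl.1 v = 0 := p.2 v hv

theorem EuclideanSimplex.continuous_coord {σ : Finset V} (v : V) :
    Continuous fun p : EuclideanSimplex K σ => p.incl.1 v :=
  (continuous_apply v).comp continuous_induced_dom

theorem continuous_realization_iff {Y : Type*} [TopologicalSpace Y] {f : Realization K → Y} :
    Continuous f ↔ ∀ σ ∈ K.faces, Continuous fun p : EuclideanSimplex K σ => f p.incl := by
  refine continuous_iSup_dom.trans ⟨fun h σ hσ => ?_, fun h σ => ?_⟩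
  · exact continuous_coinduced_dom.1 (h ⟨σ, hσ⟩)
  · exact continuous_coinduced_dom.2 (h σ.1 σ.2)

theorem Realization.isClosed_iff {s : Set (Realization K)} :
    IsClosed s ↔ ∀ σ ∈ K.faces, IsClosed (EuclideanSimplex.incl (σ := σ) ⁻¹' s) := by
  refine isClosed_iSup_iff.trans ⟨fun h σ hσ => ?_, fun h σ => ?_⟩
  · exact isClosed_coinduced.1 (h ⟨σ, hσ⟩)
  · exact isClosed_coinduced.2 (h σ.1 σ.2)

theorem Realization.exists_incl_eq (p : Realization K) :
    ∃ σ ∈ K.faces, ∃ q : EuclideanSimplex K σ, q.incl = p := by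
  obtain ⟨σ, hσ, h, -⟩ := p.2.2
  exact ⟨σ, hσ, ⟨p, h⟩, rfl⟩

theorem Realization.continuous_coord (v : V) : Continuous fun p : Realization K => p.1 v :=
  continuous_realization_iff.2 fun _ _ => EuclideanSimplex.continuous_coord v

/-- A map out of the product of the interval with a realization is continuous as soon as it is so on
each closed simplex. -/
theorem continuous_interval_prod_realization {Y : Type*} [TopologicalSpace Y]
    {H : I × Realization K → Y}
    (h : ∀ σ ∈ K.faces, Continuous fun z : I × EuclideanSimplex K σ => H (z.1, z.2.incl)) :
    Continuous H := by
  have h₁ : ∀ p : Realization K, Continuous fun t : I => H (t, p) := fun p => by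
    obtain ⟨σ, hσ, q, rfl⟩ := p.exists_incl_eq
    exact (h σ hσ).comp (Continuous.prodMk continuous_id continuous_const)
  -- Through the adjoint map into `C(I, Y)`, continuity on the product becomes continuity out of the
  -- realization, which is tested on simplices; the way back uses local compactness of the interval.
  have h₂ : Continuous fun p : Realization K => (⟨fun t : I => H (t, p), h₁ p⟩ : C(I, Y)) := by
    refine continuous_realization_iff.2 fun σ hσ => ?_
    have h₃ := ((h σ hσ).comp continuous_swap :
      Continuous fun z : EuclideanSimplex K σ × I => H (z.2, z.1.incl))
    exact (ContinuousMap.curry ⟨_, h₃⟩).continuous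
  exact (ContinuousMap.continuous_uncurry_of_continuous ⟨_, h₂⟩).comp continuous_swap

theorem Realization.finite_support (p : Realization K) : (support p.1).Finite := by
  obtain ⟨σ, -, h, -⟩ := p.2.2
  exact σ.finite_toSet.subset fun v hv => by_contra fun h' => hv (h v h')

theorem Realization.sum_eq_one (p : Realization K) {σ : Finset V} (h : ∀ v ∉ σ, p.1 v = 0) :
    ∑ v ∈ σ, p.1 v = 1 := by
  obtain ⟨τ, -, h', h₁⟩ := p.2.2
  refine Eq.trans ?_ h₁
  exact (finsum_eq_sum_of_support_subset p.1
    fun v hv => by_contra fun h'' => hv (h v h'')).symm.trans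
    (finsum_eq_sum_of_support_subset p.1 fun v hv => by_contra fun h'' => hv (h' v h''))

theorem Realization.exists_pos (p : Realization K) : ∃ v, 0 < p.1 v := by
  by_contra! h
  have := p.sum_eq_one (σ := ∅) fun v _ => le_antisymm (h v) (p.2.1 v)
  simp at this

theorem Realization.exists_face_support (p : Realization K) :
    ∃ σ ∈ K.faces, ∀ v, v ∈ σ ↔ p.1 v ≠ 0 := by
  obtain ⟨v, hv⟩ := p.exists_pos
  obtain ⟨σ, hσ, h, -⟩ := p.2.2
  refine ⟨p.finite_support.toFinset, (K.isRelLowerSet_faces hσ).2 (fun w hw => ?_) ⟨v, ?_⟩, ?_⟩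
  · exact by_contra fun h' => (by simpa using hw : p.1 w ≠ 0) (h w h')
  · simpa using hv.ne'
  · simp

/-- Maps into the realization with continuous barycentric coordinates that have locally finite
supports are continuous. -/
theorem continuous_of_locallyFinite_coord {P : Type*} [TopologicalSpace P] {q : P → Realization K}
    (hc : ∀ v, Continuous fun x => (q x).1 v)
    (hf : LocallyFinite fun v => support fun x => (q x).1 v) : Continuous q := by
  classical
  refine continuous_iff_continuousAt.2 fun x₀ => ?_
  obtain ⟨F, hF⟩ := hf.exists_finset_support x₀
  intro O hO
  obtain ⟨O', hO', hOo, hx₀⟩ := mem_nhds_iff.1 hO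
  have hcl := Realization.isClosed_iff.1 hOo.isClosed_compl
  have hD : ∀ σ : Finset V, σ ∈ K.faces → ∃ D : Set (V → ℝ), IsClosed D ∧
      (fun p : EuclideanSimplex K σ => p.incl.1) ⁻¹' D = EuclideanSimplex.incl ⁻¹' O'ᶜ :=
    fun σ hσ => isClosed_induced_iff.1 (hcl σ hσ)
  choose! D hDc hD using hD
  -- Near `x₀` all images lie in faces inside `F`. For each of these finitely many faces, landing in
  -- it but outside `O'` is a closed condition on the coordinates.
  set Z : Set P := ⋃ σ ∈ F.powerset.filter (· ∈ K.faces),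
    {x | (q x).1 ∈ D σ ∧ ∀ v ∉ σ, (q x).1 v = 0} with hZ
  have hZc : IsClosed Z := by
    refine isClosed_biUnion_finset fun σ hσ => ?_
    have h : {x | ∀ v ∉ σ, (q x).1 v = 0} = ⋂ v, ⋂ (_ : v ∉ σ), {x | (q x).1 v = 0} := by ext; simp
    have h' : IsClosed {x | ∀ v ∉ σ, (q x).1 v = 0} := h ▸ isClosed_iInter fun v =>
      isClosed_iInter fun _ => isClosed_eq (hc v) continuous_const
    exact ((hDc σ (Finset.mem_filter.1 hσ).2).preimage (continuous_pi hc)).inter h'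
  have hx₀Z : x₀ ∉ Z := by
    simp only [hZ, Set.mem_iUnion, not_exists]
    rintro σ hσ ⟨h₁, h₂⟩
    have : (⟨q x₀, h₂⟩ : EuclideanSimplex K σ) ∈ EuclideanSimplex.incl ⁻¹' O'ᶜ := by
      rw [← hD σ (Finset.mem_filter.1 hσ).2]; exact h₁
    exact this hx₀
  change ∀ᶠ x in 𝓝 x₀, q x ∈ O
  filter_upwards [hF, hZc.isOpen_compl.mem_nhds hx₀Z] with x hxF hxZ
  refine hO' (by_contra fun hx => hxZ ?_)
  obtain ⟨σ, hσ, hσs⟩ := (q x).exists_face_support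
  simp only [hZ, Set.mem_iUnion]
  have h₂ : ∀ v ∉ σ, (q x).1 v = 0 := fun v hv => by_contra fun h => hv ((hσs v).2 h)
  refine ⟨σ, Finset.mem_filter.2 ⟨Finset.mem_powerset.2 fun v hv => hxF ((hσs v).1 hv), hσ⟩, ?_, h₂⟩
  have : (⟨q x, h₂⟩ : EuclideanSimplex K σ) ∈ EuclideanSimplex.incl ⁻¹' O'ᶜ := hx
  rw [← hD σ hσ] at this
  exact this

/-- The point with barycentric coordinates proportional to the weights `a`. -/
noncomputable def Realization.normalize (K : PreAbstractSimplicialComplex V) (a : V → ℝ)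
    (h₀ : ∀ v, 0 ≤ a v) (h₁ : ∃ σ ∈ K.faces, ∀ v ∉ σ, a v = 0) (h₂ : ∃ v, 0 < a v) :
    Realization K :=
  ⟨fun v => a v / ∑ᶠ w, a w, fun v => div_nonneg (h₀ v) (finsum_nonneg h₀), by
    obtain ⟨σ, hσ, h⟩ := h₁
    obtain ⟨v, hv⟩ := h₂
    refine ⟨σ, hσ, fun v hv => by simp [h v hv], ?_⟩
    rw [← Finset.sum_div, ← finsum_eq_sum_of_support_subset a
      fun v hv => by_contra fun h' => hv (h v h')]
    refine div_self (ne_of_gt ?_)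
    exact finsum_pos h₀ ⟨v, hv⟩ (σ.finite_toSet.subset fun v hv => by_contra fun h' => hv (h v h'))⟩

theorem Realization.continuous_normalize {P : Type*} [TopologicalSpace P] {a : P → V → ℝ}
    (hc : ∀ v, Continuous fun x => a x v) (hf : LocallyFinite fun v => support fun x => a x v)
    (h₀ : ∀ x v, 0 ≤ a x v) (h₁ : ∀ x, ∃ σ ∈ K.faces, ∀ v ∉ σ, a x v = 0)
    (h₂ : ∀ x, ∃ v, 0 < a x v) (v : V) :
    Continuous fun x => (normalize K (a x) (h₀ x) (h₁ x) (h₂ x)).1 v := by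
  refine (hc v).div (continuous_finsum hc hf) fun x => ne_of_gt ?_
  obtain ⟨σ, hσ, h⟩ := h₁ x
  exact finsum_pos (h₀ x) (h₂ x)
    (σ.finite_toSet.subset fun v hv => by_contra fun h' => hv (h v h'))

theorem Realization.normalize_eq_zero_iff {a : V → ℝ} (h₀ : ∀ v, 0 ≤ a v)
    (h₁ : ∃ σ ∈ K.faces, ∀ v ∉ σ, a v = 0) (h₂ : ∃ v, 0 < a v) (v : V) :
    (normalize K a h₀ h₁ h₂).1 v = 0 ↔ a v = 0 := by
  obtain ⟨σ, -, h⟩ := id h₁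
  have := finsum_pos h₀ h₂ (σ.finite_toSet.subset fun v hv => by_contra fun h' => hv (h v h'))
  exact div_eq_zero_iff.trans (or_iff_left this.ne')

/-- The point `(1 - t) p + t q` of a simplex that contains `p` and `q`. -/
def Realization.lineMap (t : I) (p q : Realization K)
    (h : ∃ σ ∈ K.faces, ∀ v ∉ σ, p.1 v = 0 ∧ q.1 v = 0) : Realization K :=
  ⟨fun v => (1 - t) * p.1 v + t * q.1 v,
    fun v => add_nonneg (mul_nonneg (unitInterval.one_minus_nonneg t) (p.2.1 v))
      (mul_nonneg t.2.1 (q.2.1 v)), by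
    obtain ⟨σ, hσ, h⟩ := h
    refine ⟨σ, hσ, fun v hv => by simp [h v hv], ?_⟩
    rw [Finset.sum_add_distrib, ← Finset.mul_sum, ← Finset.mul_sum,
      p.sum_eq_one fun v hv => (h v hv).1, q.sum_eq_one fun v hv => (h v hv).2]
    ring⟩

/-- Two maps of a realization to itself whose values at each point lie in a common simplex are
homotopic through the straight-line homotopy. -/
theorem gHomotopic_of_mem_face {G : Type*} [SMul G (Realization K)]
    (hG : ∀ (g : G) (p q : Realization K) (t : I) h h',
      Realization.lineMap t (g • p) (g • q) h' = g • Realization.lineMap t p q h)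
    (q₀ q₁ : C(Realization K, Realization K))
    (e₀ : ∀ (g : G) p, q₀ (g • p) = g • q₀ p) (e₁ : ∀ (g : G) p, q₁ (g • p) = g • q₁ p)
    (f₀ : ∀ σ ∈ K.faces, LocallyFinite fun v => support fun p : EuclideanSimplex K σ =>
      (q₀ p.incl).1 v)
    (f₁ : ∀ σ ∈ K.faces, LocallyFinite fun v => support fun p : EuclideanSimplex K σ =>
      (q₁ p.incl).1 v)
    (h : ∀ p, ∃ σ ∈ K.faces, ∀ v ∉ σ, (q₀ p).1 v = 0 ∧ (q₁ p).1 v = 0) : GHomotopic G q₀ q₁ := by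
  refine ⟨⟨⟨fun z => Realization.lineMap z.1 (q₀ z.2) (q₁ z.2) (h z.2), ?_⟩, fun p => ?_,
    fun p => ?_⟩, fun g t p => ?_⟩
  · refine continuous_interval_prod_realization fun σ hσ => continuous_of_locallyFinite_coord ?_ ?_
    · intro v
      have c₀ := (Realization.continuous_coord v).comp
        (q₀.continuous.comp (continuous_realization_iff.1 continuous_id σ hσ))
      have c₁ := (Realization.continuous_coord v).comp
        (q₁.continuous.comp (continuous_realization_iff.1 continuous_id σ hσ))
      exact ((continuous_const.sub (continuous_subtype_val.comp continuous_fst)).mul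
        (c₀.comp continuous_snd)).add
        ((continuous_subtype_val.comp continuous_fst).mul (c₁.comp continuous_snd))
    · intro z
      obtain ⟨s, hs, hs'⟩ := f₀ σ hσ z.2
      obtain ⟨t, ht, ht'⟩ := f₁ σ hσ z.2
      refine ⟨Prod.snd ⁻¹' (s ∩ t), continuous_snd.continuousAt (Filter.inter_mem hs ht),
        (hs'.union ht').subset ?_⟩
      rintro v ⟨y, hy, hys, hyt⟩
      by_contra hv
      simp only [Set.mem_union, Set.mem_ofPred_eq, not_or, Set.not_nonempty_iff_eq_empty] at hv
      refine hy ?_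
      have h₁ : (q₀ y.2.incl).1 v = 0 :=
        by_contra fun h' => (Set.ext_iff.1 hv.1 y.2).1 ⟨h', hys⟩
      have h₂ : (q₁ y.2.incl).1 v = 0 :=
        by_contra fun h' => (Set.ext_iff.1 hv.2 y.2).1 ⟨h', hyt⟩
      simp [Realization.lineMap, h₁, h₂]
  · exact Subtype.ext (funext fun v => by simp [Realization.lineMap])
  · exact Subtype.ext (funext fun v => by simp [Realization.lineMap])
  · refine Eq.trans ?_ (hG g (q₀ p) (q₁ p) t (h p) ?_)
    · change Realization.lineMap t (q₀ (g • p)) (q₁ (g • p)) (h (g • p)) = _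
      congr 1
      · exact e₀ g p
      · exact e₁ g p
    · simpa only [e₀, e₁] using h (g • p)

end Realization

/-! ### Flowing along the superlevel sets of a weight function -/

section Flow

variable {ι : Type*}

/-- The supremum of the weights outside `τ`. -/
noncomputable def outerSup (p : ι → ℝ) (τ : Finset ι) : ℝ := ⨆ j, (τ : Set ι)ᶜ.indicator p j

/-- `τ` is a cut of the weights `p` if the weights on `τ` exceed those outside `τ`. -/
def IsCut (p : ι → ℝ) (τ : Finset ι) : Prop := ∀ i ∈ τ, outerSup p τ < p i

/-- A number in `[0, 1]` that is `1` unless `τ` is a cut of `p`, and `0` if `τ` is a cut with a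
large gap. -/
noncomputable def cutWeight (p : ι → ℝ) (τ : Finset ι) : I :=
  unitInterval.symm (∏ i ∈ τ, Set.projIcc (0 : ℝ) 1 zero_le_one (2 ^ τ.card * (p i - outerSup p τ)))

theorem bddAbove_range_of_finite_support {p : ι → ℝ} (hp : (support p).Finite) :
    BddAbove (Set.range p) := by
  refine ((hp.image p).insert 0).bddAbove.mono ?_
  rintro _ ⟨i, rfl⟩
  by_cases h : p i = 0
  · exact Or.inl h
  · exact Or.inr ⟨i, h, rfl⟩

theorem le_outerSup {p : ι → ℝ} (hp : (support p).Finite) {τ : Finset ι} {j : ι} (hj : j ∉ τ) :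
    p j ≤ outerSup p τ := by
  have := le_ciSup (f := (τ : Set ι)ᶜ.indicator p) (bddAbove_range_of_finite_support
    (hp.subset (by rw [Set.support_indicator]; exact Set.inter_subset_right))) j
  rwa [Set.indicator_of_mem (by simpa using hj)] at this

theorem outerSup_nonneg {p : ι → ℝ} (h₀ : ∀ i, 0 ≤ p i) (τ : Finset ι) : 0 ≤ outerSup p τ :=
  Real.iSup_nonneg fun _ => Set.indicator_nonneg (fun i _ => h₀ i) _

theorem outerSup_le {p : ι → ℝ} {τ : Finset ι} {r : ℝ} (hr : 0 ≤ r) (h : ∀ j ∉ τ, p j ≤ r) :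
    outerSup p τ ≤ r := by
  refine Real.iSup_le (fun j => ?_) hr
  by_cases hj : j ∈ τ
  · simpa [hj] using hr
  · simpa [hj] using h j hj

/-- Near each point the supremum is a maximum over a fixed finite set, taken in `NNReal` so that the
empty maximum is `0`. -/
theorem continuous_iSup_of_locallyFinite {P : Type*} [TopologicalSpace P] {a : P → ι → ℝ}
    (hc : ∀ i, Continuous fun x => a x i) (hf : LocallyFinite fun i => support fun x => a x i)
    (h₀ : ∀ x i, 0 ≤ a x i) : Continuous fun x => ⨆ i, a x i := by
  refine continuous_iff_continuousAt.2 fun x₀ => ?_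
  obtain ⟨F, hF⟩ := hf.exists_finset_support x₀
  have hcont : Continuous fun x => ((F.sup fun i x => (a x i).toNNReal) x : ℝ) :=
    NNReal.continuous_coe.comp
      (Continuous.finset_sup fun i _ => continuous_real_toNNReal.comp (hc i))
  refine hcont.continuousAt.congr ?_
  filter_upwards [hF] with x hx
  have hfin : (support (a x)).Finite := F.finite_toSet.subset hx
  rw [Finset.sup_apply]
  refine le_antisymm ?_ (Real.iSup_le (fun i => ?_) (NNReal.coe_nonneg _))
  · obtain h | ⟨i, -, hi⟩ := F.eq_empty_or_nonempty.imp_right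
      fun h => F.exists_mem_eq_sup h fun i => (a x i).toNNReal
    · simpa [h] using Real.iSup_nonneg (h₀ x)
    · rw [hi, Real.coe_toNNReal _ (h₀ x i)]
      exact le_ciSup (bddAbove_range_of_finite_support hfin) i
  · by_cases h : a x i = 0
    · simp [h]
    · have := Finset.le_sup (f := fun i => (a x i).toNNReal) (hx h)
      exact (Real.le_coe_toNNReal _).trans (NNReal.coe_le_coe.2 this)

theorem continuous_outerSup {P : Type*} [TopologicalSpace P] {p : P → ι → ℝ}
    (hc : ∀ i, Continuous fun x => p x i) (hf : LocallyFinite fun i => support fun x => p x i)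
    (h₀ : ∀ x i, 0 ≤ p x i) (τ : Finset ι) : Continuous fun x => outerSup (p x) τ := by
  refine continuous_iSup_of_locallyFinite (fun i => ?_) (hf.subset fun i x hx => ?_)
    fun x i => Set.indicator_nonneg (fun i _ => h₀ x i) _
  · by_cases hi : i ∈ τ
    · simpa [hi] using continuous_const
    · simpa [hi] using hc i
  · intro h
    simp only [mem_support] at hx
    exact hx (by simp [Set.indicator, h])

theorem continuous_cutWeight {P : Type*} [TopologicalSpace P] {p : P → ι → ℝ}
    (hc : ∀ i, Continuous fun x => p x i) (hf : LocallyFinite fun i => support fun x => p x i)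
    (h₀ : ∀ x i, 0 ≤ p x i) (τ : Finset ι) : Continuous fun x => cutWeight (p x) τ :=
  unitInterval.continuous_symm.comp <| continuous_finsetProd _ fun i _ =>
    continuous_projIcc.comp <| continuous_const.mul <|
      (hc i).sub (continuous_outerSup hc hf h₀ τ)

theorem cutWeight_eq_one {p : ι → ℝ} {τ : Finset ι} (h : ¬ IsCut p τ) : cutWeight p τ = 1 := by
  simp only [IsCut, not_forall, not_lt] at h
  obtain ⟨i, hi, h⟩ := h
  rw [cutWeight, Finset.prod_eq_zero hi, unitInterval.symm_zero]
  exact Set.projIcc_of_le_left _ (mul_nonpos_of_nonneg_of_nonpos (by positivity) (by linarith))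

theorem cutWeight_eq_zero {p : ι → ℝ} {τ : Finset ι}
    (h : ∀ i ∈ τ, 1 ≤ 2 ^ τ.card * (p i - outerSup p τ)) : cutWeight p τ = 0 := by
  rw [cutWeight, Finset.prod_eq_one, unitInterval.symm_one]
  exact fun i hi => Set.projIcc_of_right_le _ (h i hi)

/-! ### Order relations between cuts -/

theorem IsCut.pos {p : ι → ℝ} (h₀ : ∀ i, 0 ≤ p i) {τ : Finset ι} (h : IsCut p τ) {i : ι}
    (hi : i ∈ τ) : 0 < p i := (outerSup_nonneg h₀ τ).trans_lt (h i hi)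

theorem IsCut.lt {p : ι → ℝ} (hp : (support p).Finite) {τ : Finset ι} (h : IsCut p τ) {i j : ι}
    (hi : i ∈ τ) (hj : j ∉ τ) : p j < p i := (le_outerSup hp hj).trans_lt (h i hi)

/-- Here `τ` is only a weak cut (ties allowed), which is what limits of cuts are. An `i ∈ τ` outside
`τ'` would yield `j ∈ τ' \ τ` by cardinality, and then `p i < p j ≤ p i`. -/
theorem IsCut.superset {p : ι → ℝ} (hp : (support p).Finite) {τ τ' : Finset ι} (h : IsCut p τ')
    (hτ : ∀ i ∈ τ, ∀ j ∉ τ, p j ≤ p i) (hc : τ.card ≤ τ'.card) : τ ⊆ τ' := by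
  intro i hi
  by_contra hi'
  obtain ⟨j, hj, hj'⟩ : ∃ j ∈ τ', j ∉ τ := by
    by_contra! h'
    exact hi' (Finset.eq_of_subset_of_card_le h' hc ▸ hi)
  exact absurd (h.lt hp hj hi') (not_lt.2 (hτ i hi j hj'))

theorem IsCut.subset {p : ι → ℝ} (hp : (support p).Finite) {τ τ' : Finset ι} (h : IsCut p τ')
    (hτ : IsCut p τ) (hc : τ.card ≤ τ'.card) : τ ⊆ τ' :=
  h.superset hp (fun _ hi _ hj => (hτ.lt hp hi hj).le) hc

theorem IsCut.eq_of_card {p : ι → ℝ} (hp : (support p).Finite) {τ τ' : Finset ι} (h : IsCut p τ')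
    (hτ : IsCut p τ) (hc : τ.card = τ'.card) : τ = τ' :=
  Finset.eq_of_subset_of_card_le (h.subset hp hτ hc.le) hc.ge

/-- Weights with maximum at least `1` have a cut with a large gap. -/
theorem exists_isCut_cutWeight_eq_zero {p : ι → ℝ} (hp : (support p).Finite)
    (h₁ : ∃ i, 1 ≤ p i) : ∃ τ : Finset ι, τ.Nonempty ∧ IsCut p τ ∧ cutWeight p τ = 0 := by
  classical
  -- Lower the threshold `2⁻ⁿ` until at most as many weights reach it as the exponent says. One
  -- exponent earlier, at `n`, the set has exactly `n + 1` elements and equals the next one. The gap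
  -- is thus at least `2⁻ⁿ - 2⁻ⁿ⁻¹ = 2⁻ⁿ⁻¹`, which explains the factor `2 ^ τ.card` in `cutWeight`.
  let A : ℕ → Finset ι := fun n => hp.toFinset.filter fun i => (2⁻¹ : ℝ) ^ n ≤ p i
  have hA : ∀ n i, i ∈ A n ↔ (2⁻¹ : ℝ) ^ n ≤ p i := fun n i => by
    simp only [A, Finset.mem_filter, Set.Finite.mem_toFinset, mem_support, and_iff_right_iff_imp]
    intro h h'
    exact absurd (h.trans_eq h') (not_le.2 (by positivity))
  have hmono : ∀ n, A n ⊆ A (n + 1) := fun n i hi => by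
    rw [hA] at hi ⊢
    exact (pow_le_pow_of_le_one (by norm_num) (by norm_num) n.le_succ).trans hi
  have hex : ∃ n, (A n).card ≤ n := ⟨hp.toFinset.card, Finset.card_filter_le _ _⟩
  obtain ⟨n, hn⟩ : ∃ n, Nat.find hex = n + 1 := by
    refine Nat.exists_eq_succ_of_ne_zero fun h => ?_
    have := Nat.find_spec hex
    rw [h, Nat.le_zero, Finset.card_eq_zero] at this
    obtain ⟨i, hi⟩ := h₁
    have hi' : i ∈ A 0 := (hA 0 i).2 (by simpa using hi)
    simp [this] at hi'
  have hle : (A (n + 1)).card ≤ n + 1 := hn ▸ Nat.find_spec hex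
  have hlt : n < (A n).card := not_le.1 (Nat.find_min hex (hn ▸ n.lt_succ_self))
  have heq : A n = A (n + 1) := Finset.eq_of_subset_of_card_le (hmono n) (by omega)
  have hcard : (A n).card = n + 1 := by rw [heq] at hlt ⊢; omega
  have hgap : ∀ i ∈ A n, (2⁻¹ : ℝ) ^ (n + 1) ≤ p i - outerSup p (A n) := fun i hi => by
    have h₁ := (hA n i).1 hi
    have h₂ : outerSup p (A n) ≤ (2⁻¹ : ℝ) ^ (n + 1) :=
      outerSup_le (by positivity) fun j hj => by
        rw [heq, hA, not_le] at hj
        exact hj.le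
    rw [pow_succ] at h₂ ⊢
    linarith
  refine ⟨A n, Finset.card_pos.1 (by omega), fun i hi => ?_, cutWeight_eq_zero fun i hi => ?_⟩
  · have := hgap i hi
    have : (0 : ℝ) < 2⁻¹ ^ (n + 1) := by positivity
    linarith
  · rw [hcard]
    calc (1 : ℝ) = 2 ^ (n + 1) * 2⁻¹ ^ (n + 1) := by rw [← mul_pow]; norm_num
      _ ≤ _ := by gcongr; exact hgap i hi

variable {Y : Type*}

open Classical in
/-- Move `y` along the contraction that belongs to the cut of cardinality `n`, if there is one. -/
noncomputable def cutStep (c : Finset ι → Y → I → Y) (p : ι → ℝ) (s : I) (n : ℕ) (y : Y) : Y :=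
  if h : ∃ τ : Finset ι, τ.card = n ∧ IsCut p τ then c h.choose y (max s (cutWeight p h.choose))
  else y

/-- Move `y` along the contractions that belong to the cuts of `p` of cardinality at most `N`, the
largest cut first. -/
noncomputable def cutFlow (c : Finset ι → Y → I → Y) (p : ι → ℝ) (s : I) : ℕ → Y → Y
  -- The empty set is vacuously a cut; stopping at cardinality `1` excludes it.
  | 0, y => y
  | N + 1, y => cutFlow c p s N (cutStep c p s (N + 1) y)

theorem cutStep_of_isCut {c : Finset ι → Y → I → Y} {p : ι → ℝ} (hp : (support p).Finite) {s : I}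
    {τ : Finset ι} (h : IsCut p τ) (y : Y) :
    cutStep c p s τ.card y = c τ y (max s (cutWeight p τ)) := by
  have hex : ∃ τ' : Finset ι, τ'.card = τ.card ∧ IsCut p τ' := ⟨τ, rfl, h⟩
  rw [cutStep, dif_pos hex, h.eq_of_card hp hex.choose_spec.2 hex.choose_spec.1]

theorem cutStep_of_not {c : Finset ι → Y → I → Y} {p : ι → ℝ} {s : I} {n : ℕ}
    (h : ¬ ∃ τ : Finset ι, τ.card = n ∧ IsCut p τ) (y : Y) : cutStep c p s n y = y :=
  dif_neg h

theorem cutFlow_eq_of_le {c : Finset ι → Y → I → Y} {p : ι → ℝ} (h₀ : ∀ i, 0 ≤ p i) {s : I}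
    {σ : Finset ι} (hσ : ∀ i ∉ σ, p i = 0) {N : ℕ} (hN : σ.card ≤ N) (y : Y) :
    cutFlow c p s N y = cutFlow c p s σ.card y := by
  induction N, hN using Nat.le_induction with
  | base => rfl
  | succ n hn ih =>
    rw [cutFlow, cutStep_of_not, ih]
    rintro ⟨τ, hcard, hcut⟩
    have : τ ⊆ σ := fun i hi => by_contra fun h => (hcut.pos h₀ hi).ne' (hσ i h)
    have := Finset.card_le_card this
    omega

/-- A contraction of the subset `F` of `Y`, from a constant map at time `0` to the identity at
time `1`. -/
structure IsContraction [TopologicalSpace Y] (F : Set Y) (c : Y → I → Y) : Prop where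
  mapsTo : ∀ y ∈ F, ∀ t, c y t ∈ F
  one : ∀ y, c y 1 = y
  zero : ∀ y ∈ F, ∀ y' ∈ F, c y 0 = c y' 0
  continuousOn : ContinuousOn (uncurry c) (F ×ˢ Set.univ)

/-! ### Where the flow stays -/

variable [TopologicalSpace Y] {F : Finset ι → Set Y} {c : Finset ι → Y → I → Y}

/-- A step stays in `F τ'` for the current cut `τ'`, hence in `F τ` for all `τ ⊆ τ'`. As cuts are
nested, working from the largest down keeps the point in the sets of all cuts still to come. -/
theorem cutStep_mem (hF : Antitone F) (hc : ∀ τ, τ.Nonempty → (F τ).Nonempty →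
    IsContraction (F τ) (c τ)) {p : ι → ℝ} (hp : (support p).Finite) {s : I} {n : ℕ} {y : Y}
    (hy : ∀ τ : Finset ι, τ.Nonempty → τ.card = n + 1 → IsCut p τ → y ∈ F τ) {τ : Finset ι}
    (hτ : y ∈ F τ) (h : ∀ τ' : Finset ι, τ'.card = n + 1 → IsCut p τ' → τ ⊆ τ') :
    cutStep c p s (n + 1) y ∈ F τ := by
  by_cases hex : ∃ τ' : Finset ι, τ'.card = n + 1 ∧ IsCut p τ'
  · obtain ⟨τ', hcard, hcut⟩ := hex
    have hne : τ'.Nonempty := Finset.card_pos.1 (by omega)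
    rw [← hcard, cutStep_of_isCut hp hcut]
    have := hy τ' hne hcard hcut
    exact hF (h τ' hcard hcut) ((hc τ' hne ⟨y, this⟩).mapsTo y this _)
  · rwa [cutStep_of_not hex]

theorem cutFlow_mem (hF : Antitone F) (hc : ∀ τ, τ.Nonempty → (F τ).Nonempty →
    IsContraction (F τ) (c τ)) {p : ι → ℝ} (hp : (support p).Finite) {s : I} {N : ℕ} {y : Y}
    (hy : ∀ τ : Finset ι, τ.Nonempty → τ.card ≤ N → IsCut p τ → y ∈ F τ) {τ : Finset ι}
    (hτ : y ∈ F τ) (h : ∀ τ' : Finset ι, τ'.Nonempty → IsCut p τ' → τ ⊆ τ') :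
    cutFlow c p s N y ∈ F τ := by
  induction N generalizing y with
  | zero => exact hτ
  | succ n ih =>
    have hy' : ∀ τ : Finset ι, τ.Nonempty → τ.card = n + 1 → IsCut p τ → y ∈ F τ :=
      fun τ h₁ h₂ => hy τ h₁ h₂.le
    refine ih (fun τ' h₁ h₂ h₃ => cutStep_mem hF hc hp hy' (hy τ' h₁ (by omega) h₃)
      fun τ'' h₄ h₅ => h₅.subset hp h₃ (by omega)) (cutStep_mem hF hc hp hy' hτ fun τ' h₁ h₂ =>
        h τ' (Finset.card_pos.1 (by omega)) h₂)

theorem cutFlow_one (hc : ∀ τ, τ.Nonempty → (F τ).Nonempty → IsContraction (F τ) (c τ))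
    {p : ι → ℝ} (hp : (support p).Finite) {N : ℕ} {y : Y}
    (hy : ∀ τ : Finset ι, τ.Nonempty → τ.card ≤ N → IsCut p τ → y ∈ F τ) :
    cutFlow c p 1 N y = y := by
  induction N with
  | zero => rfl
  | succ n ih =>
    have : cutStep c p 1 (n + 1) y = y := by
      by_cases hex : ∃ τ' : Finset ι, τ'.card = n + 1 ∧ IsCut p τ'
      · obtain ⟨τ', hcard, hcut⟩ := hex
        have hne : τ'.Nonempty := Finset.card_pos.1 (by omega)
        rw [← hcard, cutStep_of_isCut hp hcut, max_eq_left unitInterval.le_one']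
        exact (hc τ' hne ⟨y, hy τ' hne hcard.le hcut⟩).one y
      · exact cutStep_of_not hex y
    rw [cutFlow, this, ih fun τ h₁ h₂ => hy τ h₁ (by omega)]

/-- At time `0` the flow forgets its starting point. -/
theorem cutFlow_zero_eq (hF : Antitone F) (hc : ∀ τ, τ.Nonempty → (F τ).Nonempty →
    IsContraction (F τ) (c τ)) {p : ι → ℝ} (hp : (support p).Finite) {σ : Finset ι}
    (hσ : IsCut p σ) (hσn : σ.Nonempty) (hw : cutWeight p σ = 0) {N : ℕ} (hN : σ.card ≤ N)
    {y y' : Y} (hy : ∀ τ : Finset ι, τ.Nonempty → τ.card ≤ N → IsCut p τ → y ∈ F τ)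
    (hy' : ∀ τ : Finset ι, τ.Nonempty → τ.card ≤ N → IsCut p τ → y' ∈ F τ) :
    cutFlow c p 0 N y = cutFlow c p 0 N y' := by
  induction N generalizing y y' with
  | zero => exact absurd hN (not_le.2 (Finset.card_pos.2 hσn))
  | succ n ih =>
    rcases hN.eq_or_lt with h | h
    · have h₁ := hy σ hσn hN hσ
      rw [cutFlow, cutFlow, ← h, cutStep_of_isCut hp hσ, cutStep_of_isCut hp hσ, hw, max_self,
        (hc σ hσn ⟨y, h₁⟩).zero y h₁ y' (hy' σ hσn hN hσ)]
    · refine ih (by omega) (fun τ h₁ h₂ h₃ => ?_) fun τ h₁ h₂ h₃ => ?_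
      · exact cutStep_mem hF hc hp (fun τ h₁ h₂ => hy τ h₁ h₂.le) (hy τ h₁ (by omega) h₃)
          fun τ'' h₄ h₅ => h₅.subset hp h₃ (by omega)
      · exact cutStep_mem hF hc hp (fun τ h₁ h₂ => hy' τ h₁ h₂.le) (hy' τ h₁ (by omega) h₃)
          fun τ'' h₄ h₅ => h₅.subset hp h₃ (by omega)

/-! ### Continuity of the flow in the weights, the time and the starting point -/

section Continuity

variable {P : Type*} [TopologicalSpace P] {p : P → ι → ℝ} {S : ι → Set P}

theorem finite_support_of_locallyFinite (hS : LocallyFinite S) (hpS : ∀ x i, p x i ≠ 0 → x ∈ S i)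
    (x : P) : (support (p x)).Finite :=
  (hS.point_finite x).subset fun i hi => hpS x i hi

/-- Being a cut is an open condition, so the issue is a point `x₀` without a cut of this size.
Nearby cuts degenerate there to weak cuts, perhaps with vanishing weights, which is why `hmF` uses
closed sets `S i` and non-strict inequalities. The contraction time tends to `1`, so the step tends
to the identity. -/
theorem continuous_cutStep (hc : ∀ τ, τ.Nonempty → (F τ).Nonempty → IsContraction (F τ) (c τ))
    (hS : LocallyFinite S) (hScl : ∀ i, IsClosed (S i)) (h₀ : ∀ x i, 0 ≤ p x i)
    (hpS : ∀ x i, p x i ≠ 0 → x ∈ S i) (hpc : ∀ i, Continuous fun x => p x i) {s : P → I}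
    (hs : Continuous s) {m : P → Y} (hm : Continuous m) (n : ℕ)
    (hmF : ∀ x (τ : Finset ι), τ.Nonempty → τ.card ≤ n + 1 → (∀ i ∈ τ, x ∈ S i) →
      (∀ i ∈ τ, ∀ j ∉ τ, p x j ≤ p x i) → m x ∈ F τ) :
    Continuous fun x => cutStep c (p x) (s x) (n + 1) (m x) := by
  have hfin := finite_support_of_locallyFinite hS hpS
  have hsup : LocallyFinite fun i => support fun x => p x i := hS.subset fun i x hx => hpS x i hx
  have hout := continuous_outerSup hpc hsup h₀
  have hw : ∀ τ, Continuous fun x => max (s x) (cutWeight (p x) τ) := fun τ =>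
    hs.max (continuous_cutWeight hpc hsup h₀ τ)
  have hcut : ∀ x τ, τ.Nonempty → τ.card = n + 1 → IsCut (p x) τ → m x ∈ F τ :=
    fun x τ hτ hcard h => hmF x τ hτ hcard.le (fun i hi => hpS x i (h.pos (h₀ x) hi).ne')
      fun i hi j hj => (h.lt (hfin x) hi hj).le
  refine continuous_iff_continuousAt.2 fun x₀ => ?_
  by_cases hex : ∃ τ : Finset ι, τ.card = n + 1 ∧ IsCut (p x₀) τ
  · obtain ⟨τ, hcard, hτ⟩ := hex
    have hne : τ.Nonempty := Finset.card_pos.1 (by omega)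
    have hev : ∀ᶠ x in 𝓝 x₀, IsCut (p x) τ :=
      (Filter.eventually_all_finset τ).2 fun i hi =>
        (hout τ).continuousAt.eventually_lt (hpc i).continuousAt (hτ i hi)
    have hx₀ := hcut x₀ τ hne hcard hτ
    have hlim : Filter.Tendsto (fun x => (m x, max (s x) (cutWeight (p x) τ))) (𝓝 x₀)
        (𝓝[F τ ×ˢ Set.univ] (m x₀, max (s x₀) (cutWeight (p x₀) τ))) :=
      tendsto_nhdsWithin_iff.2 ⟨(hm.prodMk (hw τ)).continuousAt, hev.mono fun x hx =>
        ⟨hcut x τ hne hcard hx, trivial⟩⟩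
    have hcont := ((hc τ hne ⟨_, hx₀⟩).continuousOn _ ⟨hx₀, trivial⟩).tendsto.comp hlim
    have heq : ∀ᶠ x in 𝓝 x₀, c τ (m x) (max (s x) (cutWeight (p x) τ)) =
        cutStep c (p x) (s x) (n + 1) (m x) := hev.mono fun x hx => by
      rw [← hcard, cutStep_of_isCut (hfin x) hx]
    exact ContinuousAt.congr (f := fun x => c τ (m x) (max (s x) (cutWeight (p x) τ))) hcont heq
  · intro O hO
    beta_reduce at hO
    rw [cutStep_of_not hex] at hO
    have hF₀ : ∀ᶠ x in 𝓝 x₀, ∀ i, x ∈ S i → x₀ ∈ S i := by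
      filter_upwards [hS.iInter_compl_mem_nhds hScl x₀] with x hx i hi
      by_contra h
      exact (Set.mem_iInter₂.1 hx i h) hi
    -- Cuts at points near `x₀` consist of indices `i` with `x₀ ∈ S i`, so there are finitely many
    -- candidates.
    have key : ∀ τ ∈ ((hS.point_finite x₀).toFinset.powersetCard (n + 1)), ∀ᶠ x in 𝓝 x₀,
        IsCut (p x) τ → c τ (m x) (max (s x) (cutWeight (p x) τ)) ∈ O := by
      intro τ hτ
      obtain ⟨hsub, hcard⟩ := Finset.mem_powersetCard.1 hτ
      have hne : τ.Nonempty := Finset.card_pos.1 (by omega)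
      by_cases hweak : ∀ i ∈ τ, ∀ j ∉ τ, p x₀ j ≤ p x₀ i
      · have hx₀ : m x₀ ∈ F τ := hmF x₀ τ hne hcard.le (fun i hi => by simpa using hsub hi) hweak
        have hτc := hc τ hne ⟨_, hx₀⟩
        have h₁ : max (s x₀) (cutWeight (p x₀) τ) = 1 := by
          rw [cutWeight_eq_one fun h => hex ⟨τ, hcard, h⟩, max_eq_right unitInterval.le_one']
        have h₂ := (hτc.continuousOn (m x₀, 1) ⟨hx₀, trivial⟩)
        have h₃ : uncurry (c τ) (m x₀, 1) = m x₀ := hτc.one _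
        rw [ContinuousWithinAt, h₃] at h₂
        have h₄ := mem_nhdsWithin_iff_eventually.1 (h₂ hO)
        have h₅ : Filter.Tendsto (fun x => (m x, max (s x) (cutWeight (p x) τ))) (𝓝 x₀)
            (𝓝 (m x₀, 1)) := h₁ ▸ (hm.prodMk (hw τ)).continuousAt
        exact (h₅.eventually h₄).mono fun x hx hxc => hx ⟨hcut x τ hne hcard hxc, trivial⟩
      -- A strict inversion at `x₀` persists nearby and prevents `τ` from being a cut there.
      · push Not at hweak
        obtain ⟨i, hi, j, hj, hij⟩ := hweak
        filter_upwards [(hpc i).continuousAt.eventually_lt (hpc j).continuousAt hij] with x hx hxc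
        exact absurd (hxc.lt (hfin x) hi hj) (not_lt.2 hx.le)
    change ∀ᶠ x in 𝓝 x₀, _ ∈ O
    filter_upwards [(Filter.eventually_all_finset _).2 key, hF₀, hm.continuousAt hO]
      with x hx hxF hxO
    by_cases hex' : ∃ τ : Finset ι, τ.card = n + 1 ∧ IsCut (p x) τ
    · obtain ⟨τ, hcard, hτ⟩ := hex'
      rw [← hcard, cutStep_of_isCut (hfin x) hτ]
      refine hx τ (Finset.mem_powersetCard.2 ⟨fun i hi => ?_, hcard⟩) hτ
      simpa using hxF i (hpS x i (hτ.pos (h₀ x) hi).ne')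
    · rwa [cutStep_of_not hex']

/-- The location hypothesis survives a step because a weak cut of smaller cardinality lies inside
the cut being applied, by `IsCut.superset`. -/
theorem continuous_cutFlow (hF : Antitone F)
    (hc : ∀ τ, τ.Nonempty → (F τ).Nonempty → IsContraction (F τ) (c τ))
    (hS : LocallyFinite S) (hScl : ∀ i, IsClosed (S i)) (h₀ : ∀ x i, 0 ≤ p x i)
    (hpS : ∀ x i, p x i ≠ 0 → x ∈ S i) (hpc : ∀ i, Continuous fun x => p x i) {s : P → I}
    (hs : Continuous s) {m : P → Y} (hm : Continuous m) (N : ℕ)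
    (hmF : ∀ x (τ : Finset ι), τ.Nonempty → τ.card ≤ N → (∀ i ∈ τ, x ∈ S i) →
      (∀ i ∈ τ, ∀ j ∉ τ, p x j ≤ p x i) → m x ∈ F τ) :
    Continuous fun x => cutFlow c (p x) (s x) N (m x) := by
  induction N generalizing m with
  | zero => exact hm
  | succ n ih =>
    have hfin := finite_support_of_locallyFinite hS hpS
    refine ih (continuous_cutStep hc hS hScl h₀ hpS hpc hs hm n hmF) fun x τ h₁ h₂ h₃ h₄ => ?_
    refine cutStep_mem hF hc (hfin x) (fun τ' h₅ h₆ h₇ => ?_) (hmF x τ h₁ (by omega) h₃ h₄)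
      fun τ' h₅ h₆ => h₆.superset (hfin x) h₄ (by omega)
    exact hmF x τ' h₅ h₆.le (fun i hi => hpS x i (h₇.pos (h₀ x) hi).ne')
      fun i hi j hj => (h₇.lt (hfin x) hi hj).le

end Continuity

end Flow

/-! ### Equivariant choices -/

/-- Choose stabilizer-fixed values on orbit representatives and transport them; fixedness makes the
result independent of the transporting element. -/
theorem exists_equivariant_choice {G J Ψ : Type*} [Group G] [MulAction G J]
    (act : G → Ψ → Ψ) (hact : ∀ g h ψ, act (g * h) ψ = act g (act h ψ)) (Q : J → Ψ → Prop)
    (hQ : ∀ (g : G) j ψ, Q j ψ → Q (g • j) (act g ψ))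
    (h : ∀ j, ∃ ψ, Q j ψ ∧ ∀ g : G, g • j = j → act g ψ = ψ) :
    ∃ Φ : J → Ψ, (∀ j, Q j (Φ j)) ∧ ∀ (g : G) j, Φ (g • j) = act g (Φ j) := by
  choose ψ hψ hfix using h
  let r : J → J := fun j => (Quotient.mk (MulAction.orbitRel G J) j).out
  have hr : ∀ j, ∃ g : G, g • r j = j := fun j =>
    MulAction.orbitRel_apply.1
      ((MulAction.orbitRel G J).symm (Quotient.mk_out (s := MulAction.orbitRel G J) j))
  choose k hk using hr
  have hrg : ∀ (g : G) j, r (g • j) = r j := fun g j => by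
    have : Quotient.mk (MulAction.orbitRel G J) (g • j) = Quotient.mk (MulAction.orbitRel G J) j :=
      Quotient.sound (MulAction.orbitRel_apply.2 ⟨g, rfl⟩)
    simp only [r, this]
  refine ⟨fun j => act (k j) (ψ (r j)), fun j => ?_, fun g j => ?_⟩
  · have := hQ (k j) _ _ (hψ (r j))
    rwa [hk] at this
  · have h₁ : ((k (g • j))⁻¹ * (g * k j)) • r j = r j := by
      rw [mul_smul, mul_smul, hk, inv_smul_eq_iff]
      have := hk (g • j)
      rw [hrg] at this
      exact this.symm
    have h₂ := congrArg (act (k (g • j))) (hfix (r j) _ h₁)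
    rw [← hact, mul_inv_cancel_left, hact] at h₂
    simp only [hrg, h₂]

/-! ### Equivariant contractions -/

section Contraction

variable {G ι X : Type*} [Group G] [MulAction G X]

theorem mem_inter {A : ι → Set X} {σ : Finset ι} {x : X} : x ∈ inter A σ ↔ ∀ i ∈ σ, x ∈ A i := by
  simp [inter]

theorem inter_antitone (A : ι → Set X) : Antitone (inter A) := fun _ _ h _ hx =>
  mem_inter.2 fun i hi => mem_inter.1 hx i (h hi)

theorem InvariantCover.smul_mem_iff [MulAction G ι] (A : InvariantCover G ι X) (g : G) (i : ι)
    (x : X) : g • x ∈ A.sets (g • i) ↔ x ∈ A.sets i := by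
  rw [← A.smul_sets, Set.smul_mem_smul_set_iff]

theorem InvariantCover.smul_inter [MulAction G ι] [DecidableEq ι] (A : InvariantCover G ι X) (g : G)
    (σ : Finset ι) : g • inter A.sets σ = inter A.sets (g • σ) := by
  ext x
  simp only [Set.mem_smul_set_iff_inv_smul_mem, mem_inter, Finset.mem_smul_finset,
    forall_exists_index, and_imp, forall_apply_eq_imp_iff₂]
  exact forall₂_congr fun i _ => by rw [← A.smul_mem_iff g, smul_inv_smul]

/-- `G_σ` may be larger than the stabilizer of `σ`, since different index sets can have the same
intersection. This inclusion turns `G_σ`-equivariance into the fixedness needed by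
`exists_equivariant_choice`. -/
theorem InvariantCover.mem_stab [MulAction G ι] [DecidableEq ι] (A : InvariantCover G ι X) {g : G}
    {σ : Finset ι} (h : g • σ = σ) : g ∈ stab G A.sets σ := by
  rw [stab, MulAction.mem_stabilizer_iff, A.smul_inter, h]

theorem IsContraction.conj [TopologicalSpace X] [ContinuousConstSMul G X] {F : Set X}
    {c : X → I → X} (h : IsContraction F c) (g : G) :
    IsContraction (g • F) fun y t => g • c (g⁻¹ • y) t where
  mapsTo y hy t := Set.smul_mem_smul_set (h.mapsTo _ (Set.mem_smul_set_iff_inv_smul_mem.1 hy) t)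
  one y := by rw [h.one, smul_inv_smul]
  zero y hy y' hy' := by
    rw [h.zero _ (Set.mem_smul_set_iff_inv_smul_mem.1 hy) _
      (Set.mem_smul_set_iff_inv_smul_mem.1 hy')]
  continuousOn := by
    have h₁ : Continuous fun z : X × I => (g⁻¹ • z.1, z.2) :=
      (continuous_fst.const_smul g⁻¹).prodMk continuous_snd
    exact (h.continuousOn.comp h₁.continuousOn fun z hz =>
      ⟨Set.mem_smul_set_iff_inv_smul_mem.1 hz.1, trivial⟩).const_smul g

/-- A `G`-deformation retract onto a `G`-contractible subset provides a `G`-contraction. -/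
theorem exists_gHomotopic_const {G S A : Type*} [TopologicalSpace S] [TopologicalSpace A]
    [SMul G S] [SMul G A] {B : Set S} (hB : IsGDeformationRetract G B) (hA : GContractible G A)
    (j : C(A, S)) (hj : ∀ (g : G) a, j (g • a) = g • j a) (r : ∀ x ∈ B, A)
    (hr : ∀ x hx, j (r x hx) = x) (hrc : Continuous fun x : B => r x.1 x.2)
    (hre : ∀ (g : G) x hx hx', r (g • x) hx' = g • r x hx) :
    ∃ x₀ : S, GHomotopic G (ContinuousMap.const S x₀) (ContinuousMap.id S) := by
  obtain ⟨R, hRe, hR0, hR1, -⟩ := hB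
  obtain ⟨f, h, -, -, ⟨H, hH⟩, -⟩ := hA
  let ρ : C(S, A) := ⟨fun x => r (R (1, x)) (hR1 x), hrc.comp
    ((R.continuous.comp (Continuous.prodMk continuous_const continuous_id)).subtype_mk hR1)⟩
  have hρ : ∀ (g : G) x, ρ (g • x) = g • ρ x := fun g x => by
    have h₁ : g • R (1, x) ∈ B := hRe g 1 x ▸ hR1 (g • x)
    refine Eq.trans ?_ (hre g _ (hR1 x) h₁)
    change r (R (1, g • x)) _ = _
    congr 1
    exact hRe g 1 x
  -- From the constant map, undo the contraction of `A` after retracting, then undo the retraction.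
  refine ⟨j (h PUnit.unit), GHomotopic.trans (f₁ := j.comp ρ) ?_ ?_⟩
  · refine ⟨⟨⟨fun z => j (H (z.1, ρ z.2)), by fun_prop⟩, fun x => ?_, fun x => ?_⟩,
      fun g t x => ?_⟩
    · simp
    · simp
    · change j (H (t, ρ (g • x))) = g • j (H (t, ρ x))
      rw [hρ, hH, hj]
  · refine GHomotopic.symm ⟨⟨R, hR0, fun x => ?_⟩, hRe⟩
    exact (hr _ _).symm

variable [TopologicalSpace X] [ContinuousConstSMul G X] [MulAction G ι]

/-- The members of an equivalently refined covering have compatible contractions. -/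
theorem exists_equivariant_contraction [DecidableEq ι] (A B : InvariantCover G ι X)
    (href : A.IsEquivalentRefinement B)
    (hcontr : ∀ σ ∈ (nerve A.sets).faces,
      GContractible (stab G A.sets σ) (interSub G A.sets σ)) :
    ∃ c : Finset ι → X → I → X,
      (∀ τ, τ.Nonempty → (inter B.sets τ).Nonempty → IsContraction (inter B.sets τ) (c τ)) ∧
      ∀ (g : G) τ y t, c (g • τ) (g • y) t = g • c τ y t := by
  suffices h : ∃ c : Finset ι → X → I → X, (∀ τ, τ.Nonempty → (inter B.sets τ).Nonempty →
      IsContraction (inter B.sets τ) (c τ)) ∧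
      ∀ (g : G) τ, c (g • τ) = fun y t => g • c τ (g⁻¹ • y) t by
    obtain ⟨c, hc, hce⟩ := h
    exact ⟨c, hc, fun g τ y t => by simp [hce]⟩
  refine exists_equivariant_choice (fun (g : G) c y t => g • c (g⁻¹ • y) t)
    (fun g h c => by simp [mul_smul]) (fun (τ : Finset ι) (c : X → I → X) => τ.Nonempty →
    (inter B.sets τ).Nonempty → IsContraction (inter B.sets τ) c) ?_ ?_
  · intro g τ c h h₁ h₂
    rw [← B.smul_inter] at h₂ ⊢
    exact (h (Finset.smul_finset_nonempty.1 h₁) (Set.smul_set_nonempty.1 h₂)).conj g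
  · intro σ
    by_cases hσ : σ ∈ (nerve A.sets).faces
    · obtain ⟨S, hS, hAS, hret⟩ := href.1 σ hσ
      obtain ⟨x₀, H, hH⟩ := exists_gHomotopic_const hret (hcontr σ hσ)
        ⟨fun a => (⟨a.1, hAS a.2⟩ : S), by fun_prop⟩ (fun _ _ => rfl)
        (fun x hx => ⟨x.1, hx⟩) (fun _ _ => rfl) (by fun_prop) (fun _ _ _ _ => rfl)
      classical
      -- Off `S` the point stays put: continuity is required only on `S`, while time `1` must give
      -- the identity everywhere.
      refine ⟨fun y t => if h : y ∈ S then (H (t, ⟨y, h⟩)).1 else y, fun _ _ => ⟨?_, ?_, ?_, ?_⟩,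
        fun g hg => ?_⟩
      · intro y hy t
        rw [← hS] at hy ⊢
        have hy' : y ∈ S := hy
        simp only [dif_pos hy']
        exact (H _).2
      · intro y
        split_ifs <;> simp
      · intro y hy y' hy'
        rw [← hS] at hy hy'
        have h₁ : y ∈ S := hy
        have h₂ : y' ∈ S := hy'
        simp [h₁, h₂]
      · rw [← hS, continuousOn_iff_continuous_domRestrict]
        have h₁ : Continuous fun z : ((S : Set X) ×ˢ (Set.univ : Set I) : Set (X × I)) =>
            (H (z.1.2, ⟨z.1.1, z.2.1⟩)).1 := by fun_prop
        convert h₁ using 2 with z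
        have h₂ : z.1.1 ∈ S := z.2.1
        simp [uncurry, h₂]
      · funext y t
        have hst := A.mem_stab hg
        have hmem : g⁻¹ • y ∈ S ↔ y ∈ S :=
          ⟨fun h => by simpa using S.smul_mem (⟨g, hst⟩ : stab G A.sets σ) h,
            fun h => S.smul_mem (⟨g, hst⟩⁻¹ : stab G A.sets σ) h⟩
        change g • (if h : g⁻¹ • y ∈ S then (H (t, ⟨g⁻¹ • y, h⟩)).1 else g⁻¹ • y) = _
        by_cases hy : y ∈ S
        · rw [dif_pos hy, dif_pos (hmem.2 hy)]
          have := hH ⟨g, hst⟩ t ⟨g⁻¹ • y, hmem.2 hy⟩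
          refine (congrArg Subtype.val this).symm.trans ?_
          congr 3
          exact Subtype.ext (smul_inv_smul g y)
        · rw [dif_neg hy, dif_neg (mt hmem.1 hy), smul_inv_smul]
    -- The nerves agree, so the condition is vacuous off the simplices and any invariant choice will
    -- do.
    · refine ⟨fun y _ => y, fun h₁ h₂ => absurd ?_ hσ, fun g _ => ?_⟩
      · rw [href.2]
        exact ⟨h₁, h₂⟩
      · funext y t
        exact smul_inv_smul g y

end Contraction

/-! ### Equivariant partitions of unity -/

section Partition

theorem locallyFinite_prod {X D M : Type*} [TopologicalSpace X] {B : D → Set X}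
    (hB : LocallyFinite B) {E : D × M → Set X} (hE : ∀ d, LocallyFinite fun m => E (d, m))
    (hEB : ∀ d m, E (d, m) ⊆ B d) : LocallyFinite E := by
  intro x
  obtain ⟨t, ht, hfin⟩ := hB x
  choose s hs hsfin using fun d => hE d x
  refine ⟨t ∩ ⋂ d ∈ {d | (B d ∩ t).Nonempty}, s d,
    Filter.inter_mem ht ((Filter.biInter_mem hfin).2 fun d _ => hs d),
    (hfin.biUnion fun d _ => (hsfin d).image (Prod.mk d)).subset ?_⟩
  rintro ⟨d, m⟩ ⟨y, hyE, hyt, hys⟩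
  have hd : (B d ∩ t).Nonempty := ⟨y, hEB d m hyE, hyt⟩
  exact Set.mem_biUnion (x := d) hd ⟨m, ⟨y, hyE, Set.mem_iInter₂.1 hys d hd⟩, rfl⟩

theorem exists_locallyFinite_closed_cover {X ι : Type*} [TopologicalSpace X] [T2Space X]
    [ParacompactSpace X] {A : ι → Set X} (hA : LocallyFinite A) :
    ∃ C : X → Set X, (∀ m, IsClosed (C m)) ∧ ⋃ m, C m = Set.univ ∧ LocallyFinite C ∧
      ∀ m, {i | (A i ∩ C m).Nonempty}.Finite := by
  choose W hW hWfin using hA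
  obtain ⟨v, hvo, hvc, hvf, hvW⟩ := precise_refinement (fun x => interior (W x))
    (fun x => isOpen_interior)
    (Set.eq_univ_of_forall fun x => Set.mem_iUnion.2 ⟨x, mem_interior_iff_mem_nhds.2 (hW x)⟩)
  obtain ⟨C, hCc, hCcl, hCv⟩ := exists_iUnion_eq_closed_subset hvo hvf.point_finite hvc
  refine ⟨C, hCcl, hCc, hvf.subset hCv, fun m => (hWfin m).subset fun i hi => ?_⟩
  exact hi.mono (Set.inter_subset_inter_right _ ((hCv m).trans ((hvW m).trans interior_subset)))

variable {G ι X : Type*} [Group G] [MulAction G ι]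

/-- The orbit is determined by `i`, and the admissible group elements form a coset of its
stabilizer. -/
theorem finite_setOf_smul_out_eq (i : ι) [Finite (MulAction.stabilizer G i)] :
    {d : G × MulAction.orbitRel.Quotient G ι | d.1 • d.2.out = i}.Finite := by
  rcases Set.eq_empty_or_nonempty {d : G × MulAction.orbitRel.Quotient G ι | d.1 • d.2.out = i}
    with h | ⟨⟨g₀, ω₀⟩, h₀⟩
  · exact h ▸ Set.finite_empty
  · refine (Set.finite_range fun h : MulAction.stabilizer G i => ((h : G) * g₀, ω₀)).subset ?_
    rintro ⟨g, ω⟩ h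
    have h₀ : g₀ • ω₀.out = i := h₀
    have h : g • ω.out = i := h
    have hω : ω = ω₀ := by
      rw [← Quotient.out_eq ω, ← Quotient.out_eq ω₀]
      refine Quotient.sound (MulAction.orbitRel_apply.2 ⟨g⁻¹ * g₀, ?_⟩)
      change (g⁻¹ * g₀) • ω₀.out = ω.out
      rw [mul_smul, h₀, ← h, inv_smul_smul]
    subst hω
    refine ⟨⟨g * g₀⁻¹, ?_⟩, by simp⟩
    rw [MulAction.mem_stabilizer_iff, mul_smul, inv_smul_eq_iff.2 h₀.symm, h]

variable [MulAction G X] [TopologicalSpace X] [T2Space X] [ParacompactSpace X]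
  [ContinuousConstSMul G X]

/-- An invariant locally finite closed covering has an invariant locally finite open expansion. -/
theorem InvariantCover.exists_locallyFinite_open_expansion (A : InvariantCover G ι X)
    (hcl : ∀ i, IsClosed (A.sets i)) (hfin : LocallyFinite A.sets)
    (hst : ∀ i, (A.sets i).Nonempty → Finite (MulAction.stabilizer G i)) :
    ∃ V : ι → Set X, (∀ i, IsOpen (V i)) ∧ (∀ i, A.sets i ⊆ V i) ∧ LocallyFinite V ∧
      ∀ (g : G) i x, x ∈ V i → g • x ∈ V (g • i) := by
  obtain ⟨C, hCcl, hCcov, hCfin, hCA⟩ := exists_locallyFinite_closed_cover hfin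
  -- The translates of the `C m` need not be locally finite together. Cutting with a representative
  -- member first places each piece inside `A.sets (g • ω.out)`, and each index with nonempty member
  -- arises from finitely many `(g, ω)`.
  let E : (G × MulAction.orbitRel.Quotient G ι) × X → Set X :=
    fun e => e.1.1 • (C e.2 ∩ A.sets e.1.2.out)
  have hB : LocallyFinite fun d : G × MulAction.orbitRel.Quotient G ι =>
      A.sets (d.1 • d.2.out) := by
    intro x
    obtain ⟨t, ht, htf⟩ := hfin x
    refine ⟨t, ht, (htf.biUnion (t := fun i => {d | d.1 • d.2.out = i}) fun i hi => ?_).subset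
      fun d hd => Set.mem_biUnion (x := d.1 • d.2.out) hd rfl⟩
    have := hst i (hi.mono Set.inter_subset_left)
    exact finite_setOf_smul_out_eq i
  have hEfin : LocallyFinite E := by
    refine locallyFinite_prod hB (fun d => ?_) fun d m => ?_
    · have h₁ : LocallyFinite fun m => C m ∩ A.sets d.2.out :=
        hCfin.subset fun m => Set.inter_subset_left
      refine (h₁.preimage_continuous (continuous_const_smul d.1⁻¹)).subset fun m x hx => ?_
      exact Set.mem_smul_set_iff_inv_smul_mem.1 hx
    · exact (Set.smul_set_mono Set.inter_subset_right).trans (A.smul_sets _ _).subset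
  have hEcl : ∀ e, IsClosed (E e) := fun e => ((hCcl _).inter (hcl _)).smul _
  have hEA : ∀ e, {i | (A.sets i ∩ E e).Nonempty}.Finite := by
    rintro ⟨⟨g, ω⟩, m⟩
    refine ((hCA m).image (g • ·)).subset ?_
    rintro i ⟨x, hxA, hxE⟩
    have hx := Set.mem_smul_set_iff_inv_smul_mem.1 hxE
    exact ⟨g⁻¹ • i, ⟨g⁻¹ • x, (A.smul_mem_iff _ _ _).2 hxA, hx.1⟩, smul_inv_smul _ _⟩
  have hEcov : ∀ x, ∃ e, x ∈ E e := by
    intro x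
    obtain ⟨i, hi⟩ := Set.mem_iUnion.1 (A.iUnion_sets.symm ▸ Set.mem_univ x : x ∈ ⋃ i, A.sets i)
    obtain ⟨g, hg⟩ : ∃ g : G, g • (Quotient.mk (MulAction.orbitRel G ι) i).out = i :=
      MulAction.orbitRel_apply.1
        ((MulAction.orbitRel G ι).symm (Quotient.mk_out (s := MulAction.orbitRel G ι) i))
    obtain ⟨m, hm⟩ := Set.mem_iUnion.1 (hCcov.symm ▸ Set.mem_univ (g⁻¹ • x) :
      g⁻¹ • x ∈ ⋃ m, C m)
    refine ⟨((g, Quotient.mk _ i), m), Set.mem_smul_set_iff_inv_smul_mem.2 ⟨hm, ?_⟩⟩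
    rw [← A.smul_mem_iff g, smul_inv_smul]
    exact hg.symm ▸ hi
  -- A piece that meets this complement must meet `A.sets i`, which happens for only finitely many
  -- `i` per piece.
  refine ⟨fun i => (⋃ e : {e // Disjoint (A.sets i) (E e)}, E e)ᶜ, fun i => ?_, fun i x hx => ?_,
    fun x => ?_, fun g i x hx => ?_⟩
  · exact ((hEfin.comp_injective Subtype.val_injective).isClosed_iUnion
      fun e => hEcl e.1).isOpen_compl
  · simp only [Set.mem_compl_iff, Set.mem_iUnion, not_exists]
    exact fun e he => Set.disjoint_left.1 e.2 hx he
  · obtain ⟨t, ht, htf⟩ := hEfin x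
    refine ⟨t, ht, (htf.biUnion fun e _ => hEA e).subset ?_⟩
    rintro i ⟨y, hyV, hyt⟩
    obtain ⟨e, he⟩ := hEcov y
    refine Set.mem_biUnion (x := e) ⟨y, he, hyt⟩ (Set.not_disjoint_iff_nonempty_inter.1 fun h => ?_)
    exact hyV (Set.mem_iUnion.2 ⟨⟨e, h⟩, he⟩)
  · simp only [Set.mem_compl_iff, Set.mem_iUnion, not_exists] at hx ⊢
    rintro ⟨⟨⟨k, ω⟩, m⟩, he⟩ hxe
    have hxe := Set.mem_smul_set_iff_inv_smul_mem.1 hxe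
    refine hx ⟨((g⁻¹ * k, ω), m), ?_⟩ (Set.mem_smul_set_iff_inv_smul_mem.2 (by
      simpa [mul_smul] using hxe))
    refine Set.disjoint_left.2 fun y hyA hyE => Set.disjoint_left.1 he
      ((A.smul_mem_iff g i y).2 hyA) (Set.mem_smul_set_iff_inv_smul_mem.2 ?_)
    have := Set.mem_smul_set_iff_inv_smul_mem.1 hyE
    simpa [mul_smul] using this

/-- An invariant family of bump functions that are subordinate to an invariant open covering. -/
theorem InvariantCover.exists_equivariant_bump (A U : InvariantCover G ι X)
    (hcl : ∀ i, IsClosed (A.sets i)) (hfin : LocallyFinite A.sets) (hU : ∀ i, IsOpen (U.sets i))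
    (hAU : ∀ i, A.sets i ⊆ U.sets i)
    (hst : ∀ i, (A.sets i).Nonempty → Finite (MulAction.stabilizer G i)) :
    ∃ (φ : ι → X → ℝ) (S : ι → Set X), (∀ i, Continuous (φ i)) ∧ (∀ i x, 0 ≤ φ i x) ∧
      (∀ x, ∃ i, 0 < φ i x) ∧ (∀ (g : G) i x, φ (g • i) (g • x) = φ i x) ∧ LocallyFinite S ∧
      (∀ i, IsClosed (S i)) ∧ (∀ i, S i ⊆ U.sets i) ∧ ∀ i x, φ i x ≠ 0 → x ∈ S i := by
  obtain ⟨V, hVo, hAV, hVfin, hVe⟩ := A.exists_locallyFinite_open_expansion hcl hfin hst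
  obtain ⟨ψ, hψ, hψe⟩ : ∃ ψ : ι → X → ℝ, (∀ i, Continuous (ψ i) ∧
      (∀ x, x ∉ V i ∩ U.sets i → ψ i x = 0) ∧ ∀ x ∈ A.sets i, 1 ≤ ψ i x) ∧
      ∀ (g : G) i, ψ (g • i) = fun x => ψ i (g⁻¹ • x) := by
    have hVe' : ∀ (g : G) i x, x ∉ V (g • i) ∩ U.sets (g • i) → g⁻¹ • x ∉ V i ∩ U.sets i :=
      fun g i x hx hx' => hx (by
        simpa using And.intro (hVe g _ _ hx'.1) ((U.smul_mem_iff g _ _).2 hx'.2))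
    have hAe : ∀ (g : G) i x, x ∈ A.sets (g • i) → g⁻¹ • x ∈ A.sets i := fun g i x hx => by
      rwa [← A.smul_mem_iff g, smul_inv_smul]
    refine exists_equivariant_choice (fun (g : G) (f : X → ℝ) x => f (g⁻¹ • x))
      (fun g h f => by simp [mul_smul]) (fun i f => Continuous f ∧
        (∀ x, x ∉ V i ∩ U.sets i → f x = 0) ∧ ∀ x ∈ A.sets i, 1 ≤ f x) ?_ fun i => ?_
    · rintro g i f ⟨h₁, h₂, h₃⟩
      exact ⟨h₁.comp (continuous_const_smul g⁻¹), fun x hx => h₂ _ (hVe' g i x hx),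
        fun x hx => h₃ _ (hAe g i x hx)⟩
    · rcases (A.sets i).eq_empty_or_nonempty with he | hne
      · exact ⟨fun _ => 0, ⟨continuous_const, fun _ _ => rfl, fun x hx => by simp [he] at hx⟩,
          fun _ _ => rfl⟩
      have := hst i hne
      cases nonempty_fintype (MulAction.stabilizer G i)
      obtain ⟨f, hf₀, hf₁, hf⟩ := exists_continuous_zero_one_of_isClosed
        ((hVo i).inter (hU i)).isClosed_compl (hcl i)
        (Set.disjoint_left.2 fun x hx hxA => hx ⟨hAV i hxA, hAU i hxA⟩)
      -- Summing over the finite stabilizer gives invariance; the summand of the identity alone is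
      -- `1` on `A.sets i`.
      refine ⟨fun x => ∑ h : MulAction.stabilizer G i, f ((h : G)⁻¹ • x), ⟨?_, fun x hx => ?_,
        fun x hx => ?_⟩, fun g hg => ?_⟩
      · exact continuous_finsetSum _ fun h _ => f.continuous.comp (continuous_const_smul _)
      · refine Finset.sum_eq_zero fun h _ => hf₀ (hVe' h i x ?_)
        rwa [MulAction.mem_stabilizer_iff.1 h.2]
      · have h₁ := Finset.single_le_sum (f := fun h : MulAction.stabilizer G i => f ((h : G)⁻¹ • x))
          (fun h _ => (hf _).1) (Finset.mem_univ 1)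
        have h₂ : f x = 1 := hf₁ hx
        simpa [h₂] using h₁
      · funext x
        refine Fintype.sum_equiv (Equiv.mulLeft (⟨g, hg⟩ : MulAction.stabilizer G i)) _ _
          fun h => ?_
        simp [mul_smul]
  -- Truncating at `1 / 2` leaves room for a closed set between the region where the function is
  -- nonzero and the open set.
  refine ⟨fun i x => max (ψ i x - 1 / 2) 0, fun i => {x | 1 / 2 ≤ ψ i x}, fun i => ?_,
    fun i x => le_max_right _ _, fun x => ?_, fun g i x => ?_, hVfin.subset fun i x hx => ?_,
    fun i => ?_, fun i x hx => ?_, fun i x hx => ?_⟩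
  · exact ((hψ i).1.sub continuous_const).max continuous_const
  · obtain ⟨i, hi⟩ := Set.mem_iUnion.1 (A.iUnion_sets.symm ▸ Set.mem_univ x : x ∈ ⋃ i, A.sets i)
    have := (hψ i).2.2 x hi
    exact ⟨i, lt_max_of_lt_left (by linarith)⟩
  · simp [hψe]
  · by_contra h
    have h₁ := (hψ i).2.1 x fun h' => h h'.1
    have h₂ : 1 / 2 ≤ ψ i x := hx
    norm_num [h₁] at h₂
  · exact isClosed_le continuous_const (hψ i).1
  · by_contra h
    have h₁ := (hψ i).2.1 x fun h' => h h'.2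
    have h₂ : 1 / 2 ≤ ψ i x := hx
    norm_num [h₁] at h₂
  · by_contra h
    have h₂ : ¬ 1 / 2 ≤ ψ i x := h
    exact hx (max_eq_right (by linarith))

end Partition

/-! ### The complete flow and its equivariance -/

section TotalFlow

variable {ι Y : Type*}

/-- Move `y` along the contractions that belong to all cuts of `p`, the largest cut first. -/
noncomputable def totalFlow (c : Finset ι → Y → I → Y) (p : ι → ℝ) (s : I) (y : Y) : Y :=
  cutFlow c p s (support p).ncard y

/-- The size of the support is a canonical step count, suited to equivariance, but it jumps. Any
finite set containing the support gives the same flow, so the count can be fixed locally. -/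
theorem totalFlow_eq {c : Finset ι → Y → I → Y} {p : ι → ℝ} (h₀ : ∀ i, 0 ≤ p i) {s : I}
    {σ : Finset ι} (hσ : ∀ i ∉ σ, p i = 0) (y : Y) :
    totalFlow c p s y = cutFlow c p s σ.card y := by
  have hsub : support p ⊆ σ := fun i hi => by_contra fun h => hi (hσ i h)
  have hfin : (support p).Finite := σ.finite_toSet.subset hsub
  rw [totalFlow, Set.ncard_eq_toFinset_card _ hfin]
  refine (cutFlow_eq_of_le h₀ (fun i hi => ?_) (Finset.card_le_card ?_) y).symm
  · simpa using hi
  · simpa using hsub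

/-! ### Equivariance of the flow -/

section Equivariance

variable {G : Type*} [Group G] [MulAction G ι] [DecidableEq ι]

theorem outerSup_smul (g : G) (p : ι → ℝ) (τ : Finset ι) :
    outerSup (fun i => p (g⁻¹ • i)) (g • τ) = outerSup p τ :=
  (MulAction.toPerm g⁻¹).iSup_congr fun i => by
    by_cases h : g⁻¹ • i ∈ τ
    · rw [Set.indicator_of_notMem (by simpa using h), Set.indicator_of_notMem]
      exact fun h' => h' (Finset.inv_smul_mem_iff.1 h)
    · rw [Set.indicator_of_mem (by simpa using h), Set.indicator_of_mem, MulAction.toPerm_apply]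
      exact fun h' => h (Finset.inv_smul_mem_iff.2 h')

theorem isCut_smul {g : G} {p : ι → ℝ} {τ : Finset ι} :
    IsCut (fun i => p (g⁻¹ • i)) (g • τ) ↔ IsCut p τ := by
  simp only [IsCut, outerSup_smul, Finset.mem_smul_finset, forall_exists_index, and_imp,
    forall_apply_eq_imp_iff₂, inv_smul_smul]

theorem cutWeight_smul (g : G) (p : ι → ℝ) (τ : Finset ι) :
    cutWeight (fun i => p (g⁻¹ • i)) (g • τ) = cutWeight p τ := by
  rw [cutWeight, cutWeight, outerSup_smul, Finset.card_smul_finset, Finset.smul_finset_def,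
    Finset.prod_image (MulAction.injective g).injOn]
  simp only [inv_smul_smul]

variable [MulAction G Y] {c : Finset ι → Y → I → Y}

theorem cutStep_smul (hc : ∀ (g : G) τ y t, c (g • τ) (g • y) t = g • c τ y t)
    {p : ι → ℝ} (hp : (support p).Finite) (g : G) (s : I) (n : ℕ) (y : Y) :
    cutStep c (fun i => p (g⁻¹ • i)) s n (g • y) = g • cutStep c p s n y := by
  have hp' : (support fun i => p (g⁻¹ • i)).Finite :=
    hp.preimage (MulAction.injective g⁻¹).injOn
  by_cases hex : ∃ τ : Finset ι, τ.card = n ∧ IsCut p τ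
  · obtain ⟨τ, rfl, hτ⟩ := hex
    rw [cutStep_of_isCut hp hτ]
    conv_lhs => rw [← Finset.card_smul_finset g τ]
    rw [cutStep_of_isCut hp' (isCut_smul.2 hτ), cutWeight_smul, hc]
  · rw [cutStep_of_not hex, cutStep_of_not]
    rintro ⟨τ, hcard, hτ⟩
    refine hex ⟨g⁻¹ • τ, by rwa [Finset.card_smul_finset], ?_⟩
    rwa [← isCut_smul (g := g), smul_inv_smul]

theorem totalFlow_smul (hc : ∀ (g : G) τ y t, c (g • τ) (g • y) t = g • c τ y t)
    {p : ι → ℝ} (hp : (support p).Finite) (g : G) (s : I) (y : Y) :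
    totalFlow c (fun i => p (g⁻¹ • i)) s (g • y) = g • totalFlow c p s y := by
  have hN : (support fun i => p (g⁻¹ • i)).ncard = (support p).ncard :=
    Set.ncard_preimage_of_injective_subset_range (s := support p) (MulAction.injective g⁻¹)
      fun i _ => ⟨g • i, inv_smul_smul g i⟩
  rw [totalFlow, totalFlow, hN]
  generalize (support p).ncard = N
  induction N generalizing y with
  | zero => rfl
  | succ n ih => rw [cutFlow, cutFlow, cutStep_smul hc hp, ih]

end Equivariance

end TotalFlow

/-! ### Capped weights -/

section Cap

variable {ι : Type*}

/-- The weights `p`, scaled so that all weights above half of the maximum become `1`. -/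
noncomputable def cap (p : ι → ℝ) (i : ι) : ℝ := min 1 (2 * p i / ⨆ j, p j)

theorem iSup_pos {p : ι → ℝ} (hp : (support p).Finite) (h₁ : ∃ i, 0 < p i) : 0 < ⨆ i, p i :=
  h₁.choose_spec.trans_le (le_ciSup (bddAbove_range_of_finite_support hp) _)

theorem exists_iSup_lt {p : ι → ℝ} (hp : (support p).Finite) (h₁ : ∃ i, 0 < p i) :
    ∃ i, ⨆ j, p j < 2 * p i := by
  have := iSup_pos hp h₁
  have : Nonempty ι := ⟨h₁.choose⟩
  obtain ⟨i, hi⟩ := exists_lt_of_lt_ciSup (show (⨆ j, p j) / 2 < ⨆ j, p j by linarith)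
  exact ⟨i, by linarith⟩

theorem cap_nonneg {p : ι → ℝ} (h₀ : ∀ i, 0 ≤ p i) (i : ι) : 0 ≤ cap p i :=
  le_min zero_le_one (div_nonneg (by linarith [h₀ i]) (Real.iSup_nonneg h₀))

theorem cap_eq_zero {p : ι → ℝ} {i : ι} (h : p i = 0) : cap p i = 0 := by simp [cap, h]

theorem finite_support_cap {p : ι → ℝ} (hp : (support p).Finite) : (support (cap p)).Finite :=
  hp.subset fun _ hi h => hi (cap_eq_zero h)

theorem cap_eq_one {p : ι → ℝ} (hp : (support p).Finite) (h₁ : ∃ i, 0 < p i) {i : ι}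
    (hi : ⨆ j, p j ≤ 2 * p i) : cap p i = 1 :=
  min_eq_left ((one_le_div (iSup_pos hp h₁)).2 hi)

theorem exists_one_le_cap {p : ι → ℝ} (hp : (support p).Finite) (h₁ : ∃ i, 0 < p i) :
    ∃ i, 1 ≤ cap p i := by
  obtain ⟨i, hi⟩ := exists_iSup_lt hp h₁
  exact ⟨i, (cap_eq_one hp h₁ hi.le).ge⟩

theorem iSup_smul {G : Type*} [Group G] [MulAction G ι] (g : G) (p : ι → ℝ) :
    ⨆ i, p (g⁻¹ • i) = ⨆ i, p i :=
  (MulAction.toPerm g⁻¹).iSup_congr fun _ => rfl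

theorem cap_smul {G : Type*} [Group G] [MulAction G ι] (g : G) (p : ι → ℝ) :
    cap (fun i => p (g⁻¹ • i)) = fun i => cap p (g⁻¹ • i) := by
  funext i
  simp only [cap, iSup_smul]

theorem continuous_cap {P : Type*} [TopologicalSpace P] {p : P → ι → ℝ}
    (hc : ∀ i, Continuous fun x => p x i) (hf : LocallyFinite fun i => support fun x => p x i)
    (h₀ : ∀ x i, 0 ≤ p x i) (h₁ : ∀ x, ∃ i, 0 < p x i) (i : ι) :
    Continuous fun x => cap (p x) i :=
  continuous_const.min <| (continuous_const.mul (hc i)).div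
    (continuous_iSup_of_locallyFinite hc hf h₀) fun x =>
      (iSup_pos (finite_support_of_locallyFinite hf (fun _ _ h => h) x) (h₁ x)).ne'

end Cap

/-! ### The map from the nerve to the space -/

section NerveToSpace

variable {ι Y : Type*} [TopologicalSpace Y] {K : PreAbstractSimplicialComplex ι}
  {F : Finset ι → Set Y} {c : Finset ι → Y → I → Y}

theorem totalFlow_zero_eq (hF : Antitone F)
    (hc : ∀ τ, τ.Nonempty → (F τ).Nonempty → IsContraction (F τ) (c τ)) {p : ι → ℝ}
    (h₀ : ∀ i, 0 ≤ p i) (h₁ : ∃ i, 1 ≤ p i) {σ : Finset ι} (hσ : ∀ i ∉ σ, p i = 0)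
    {y y' : Y} (hy : ∀ τ ⊆ σ, τ.Nonempty → IsCut p τ → y ∈ F τ)
    (hy' : ∀ τ ⊆ σ, τ.Nonempty → IsCut p τ → y' ∈ F τ) :
    totalFlow c p 0 y = totalFlow c p 0 y' := by
  have hp : (support p).Finite :=
    σ.finite_toSet.subset fun i hi => by_contra fun h => hi (hσ i h)
  have hsub : ∀ τ, IsCut p τ → τ ⊆ σ := fun τ hτ i hi =>
    by_contra fun h => (hτ.pos h₀ hi).ne' (hσ i h)
  obtain ⟨τ, hne, hτ, hw⟩ := exists_isCut_cutWeight_eq_zero hp h₁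
  rw [totalFlow_eq h₀ hσ, totalFlow_eq h₀ hσ]
  exact cutFlow_zero_eq hF hc hp hτ hne hw (Finset.card_le_card (hsub τ hτ))
    (fun τ h₁ _ h₂ => hy τ (hsub τ h₂) h₁ h₂) (fun τ h₁ _ h₂ => hy' τ (hsub τ h₂) h₁ h₂)

/-- The flow of the capped barycentric coordinates of `p`, started at a point of `F σ`, where `σ` is
a face that contains `p`. -/
noncomputable def nerveMap (c : Finset ι → Y → I → Y) (hK : ∀ σ ∈ K.faces, (F σ).Nonempty)
    (p : Realization K) : Y :=
  totalFlow c (cap p.1) 0 (hK _ p.exists_face_support.choose_spec.1).choose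

theorem isCut_cap_ne_zero {p : ι → ℝ} (h₀ : ∀ i, 0 ≤ p i) {τ : Finset ι} (h : IsCut (cap p) τ)
    {i : ι} (hi : i ∈ τ) : p i ≠ 0 :=
  fun h' => (h.pos (cap_nonneg h₀) hi).ne' (cap_eq_zero h')

/-- Freedom in the starting point is what makes `nerveMap`, defined by arbitrary choices, continuous
and equivariant. -/
theorem nerveMap_eq (hF : Antitone F)
    (hc : ∀ τ, τ.Nonempty → (F τ).Nonempty → IsContraction (F τ) (c τ))
    (hK : ∀ σ ∈ K.faces, (F σ).Nonempty) (p : Realization K) {y : Y}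
    (hy : ∀ τ : Finset ι, τ.Nonempty → (∀ i ∈ τ, p.1 i ≠ 0) → y ∈ F τ) :
    nerveMap c hK p = totalFlow c (cap p.1) 0 y := by
  have hσ := p.exists_face_support.choose_spec
  refine totalFlow_zero_eq hF hc (cap_nonneg p.2.1)
    (exists_one_le_cap p.finite_support p.exists_pos) (σ := p.exists_face_support.choose)
    (fun i hi => cap_eq_zero (by_contra fun h => hi ((hσ.2 i).2 h)))
    (fun τ hτ _ _ => hF hτ (hK _ hσ.1).choose_spec)
    fun τ _ hne hτ => hy τ hne fun i hi => isCut_cap_ne_zero p.2.1 hτ hi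

/-- The vertices of `τ` have the maximal capped weight `1`, so no nonempty cut can omit one of them,
and `cutFlow_mem` applies. -/
theorem nerveMap_mem (hF : Antitone F)
    (hc : ∀ τ, τ.Nonempty → (F τ).Nonempty → IsContraction (F τ) (c τ))
    (hK : ∀ σ ∈ K.faces, (F σ).Nonempty) (p : Realization K) {τ : Finset ι}
    (h : ∀ i ∈ τ, ⨆ j, p.1 j ≤ 2 * p.1 i) : nerveMap c hK p ∈ F τ := by
  have hσ := p.exists_face_support.choose_spec
  have hy := (hK _ p.exists_face_support.choose_spec.1).choose_spec
  have hfin := finite_support_cap p.finite_support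
  have hpos := iSup_pos p.finite_support p.exists_pos
  refine cutFlow_mem hF hc hfin (fun τ' h₁ _ h₃ => hF (fun i hi => (hσ.2 i).2 ?_) hy)
    (hF (fun i hi => (hσ.2 i).2 fun h' => ?_) hy) fun τ' ⟨j, hj⟩ hcut i hi => ?_
  · exact isCut_cap_ne_zero p.2.1 h₃ hi
  · have := h i hi
    linarith
  · by_contra hi'
    have h₁ := hcut.lt hfin hj hi'
    rw [cap_eq_one p.finite_support p.exists_pos (h i hi)] at h₁
    exact absurd h₁ (not_lt.2 (min_le_left _ _))

theorem locallyFinite_support_of_forall {P : Type*} [TopologicalSpace P] {a : P → ι → ℝ}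
    {σ : Finset ι} (h : ∀ x, ∀ i ∉ σ, a x i = 0) :
    LocallyFinite fun i => support fun x => a x i := fun _ =>
  ⟨Set.univ, Filter.univ_mem, σ.finite_toSet.subset fun i ⟨x, hx, _⟩ =>
    by_contra fun hi => hx (h x i hi)⟩

theorem continuous_nerveMap (hF : Antitone F)
    (hc : ∀ τ, τ.Nonempty → (F τ).Nonempty → IsContraction (F τ) (c τ))
    (hK : ∀ σ ∈ K.faces, (F σ).Nonempty) : Continuous (nerveMap (K := K) c hK) := by
  refine continuous_realization_iff.2 fun σ hσ => ?_
  obtain ⟨y, hy⟩ := hK σ hσ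
  have hzero : ∀ (p : EuclideanSimplex K σ), ∀ i ∉ σ, p.incl.1 i = 0 := fun p i hi => p.eq_zero hi
  have heq : ∀ p : EuclideanSimplex K σ,
      nerveMap c hK p.incl = cutFlow c (cap p.incl.1) 0 σ.card y := fun p => by
    rw [nerveMap_eq hF hc hK p.incl (y := y), totalFlow_eq (cap_nonneg p.incl.2.1)
      fun i hi => cap_eq_zero (hzero p i hi)]
    exact fun τ _ hτ => hF (fun i hi => by_contra fun h => hτ i hi (hzero p i h)) hy
  simp only [heq]
  refine continuous_cutFlow (S := fun i => {_p : EuclideanSimplex K σ | i ∈ σ}) hF hc (fun p => ?_)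
    (fun i => isClosed_const) (fun p i => cap_nonneg p.incl.2.1 i)
    (fun p i h => by_contra fun hi => h (cap_eq_zero (hzero p i hi)))
    (fun i => continuous_cap EuclideanSimplex.continuous_coord
      (locallyFinite_support_of_forall hzero) (fun p => p.incl.2.1) (fun p => p.incl.exists_pos) i)
    continuous_const continuous_const _ fun p τ _ _ h _ => hF h hy
  exact ⟨Set.univ, Filter.univ_mem, σ.finite_toSet.subset fun i ⟨_, hx, _⟩ => hx⟩

end NerveToSpace

/-! ### The equivariant nerve theorem -/

section Main

variable {G ι X : Type*} [Group G] [MulAction G ι] [MulAction G X]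

theorem InvariantCover.smul_coord (A : InvariantCover G ι X) (g : G)
    (p : Realization (nerve A.sets)) : (g • p).1 = fun i => p.1 (g⁻¹ • i) := rfl

theorem InvariantCover.normalize_smul (A : InvariantCover G ι X) (g : G) {a b : ι → ℝ}
    (h₀ h₁ h₂ h₀' h₁' h₂') (h : b = fun i => a (g⁻¹ • i)) :
    Realization.normalize (nerve A.sets) b h₀' h₁' h₂' =
      g • Realization.normalize (nerve A.sets) a h₀ h₁ h₂ := by
  subst h
  refine Subtype.ext (funext fun i => ?_)
  change a (g⁻¹ • i) / ∑ᶠ j, a (g⁻¹ • j) = a (g⁻¹ • i) / ∑ᶠ j, a j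
  rw [← finsum_comp_equiv (MulAction.toPerm g⁻¹) (f := a)]
  rfl

theorem InvariantCover.finite_stabilizer (A : InvariantCover G ι X)
    (hstab : ∀ σ ∈ (nerve A.sets).faces, Finite (stab G A.sets σ)) (i : ι)
    (hi : (A.sets i).Nonempty) : Finite (MulAction.stabilizer G i) := by
  classical
  obtain ⟨x, hx⟩ := hi
  have := hstab {i} ⟨Finset.singleton_nonempty i, x, by simpa [inter] using hx⟩
  have hle : MulAction.stabilizer G i ≤ stab G A.sets {i} := fun g hg => A.mem_stab (by
    rw [Finset.smul_finset_singleton, MulAction.mem_stabilizer_iff.1 hg])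
  exact Finite.of_injective _ (Subgroup.inclusion_injective hle)

/-- The map that pushes a point of the realization towards the vertices with large weights. -/
theorem exists_push_to_large (A : InvariantCover G ι X) :
    ∃ θ : C(Realization (nerve A.sets), Realization (nerve A.sets)),
      (∀ (g : G) p, θ (g • p) = g • θ p) ∧
      ∀ p i, (θ p).1 i ≠ 0 → ⨆ j, p.1 j ≤ 2 * p.1 i ∧ p.1 i ≠ 0 := by
  -- Positive exactly at the vertices with more than half the maximal weight; the maximum is
  -- positive, so one exists.
  let a : Realization (nerve A.sets) → ι → ℝ := fun p i => max (2 * p.1 i - ⨆ j, p.1 j) 0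
  have ha : ∀ p i, a p i ≠ 0 → ⨆ j, p.1 j ≤ 2 * p.1 i ∧ p.1 i ≠ 0 := fun p i h => by
    have h₁ : ⨆ j, p.1 j < 2 * p.1 i := by
      by_contra h'
      exact h (max_eq_right (by linarith))
    have := iSup_pos p.finite_support p.exists_pos
    exact ⟨h₁.le, fun h' => by linarith⟩
  have h₀ : ∀ p i, 0 ≤ a p i := fun p i => le_max_right _ _
  have h₁ : ∀ p, ∃ σ ∈ (nerve A.sets).faces, ∀ i ∉ σ, a p i = 0 := fun p => by
    obtain ⟨σ, hσ, h⟩ := p.exists_face_support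
    exact ⟨σ, hσ, fun i hi => by_contra fun h' => hi ((h i).2 (ha p i h').2)⟩
  have h₂ : ∀ p, ∃ i, 0 < a p i := fun p => by
    obtain ⟨i, hi⟩ := exists_iSup_lt p.finite_support p.exists_pos
    exact ⟨i, lt_max_of_lt_left (by linarith)⟩
  have hz : ∀ p i, (Realization.normalize _ (a p) (h₀ p) (h₁ p) (h₂ p)).1 i ≠ 0 → a p i ≠ 0 :=
    fun p i => mt (Realization.normalize_eq_zero_iff (h₀ p) (h₁ p) (h₂ p) i).2
  refine ⟨⟨fun p => Realization.normalize _ (a p) (h₀ p) (h₁ p) (h₂ p),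
    continuous_realization_iff.2 fun σ hσ => ?_⟩, 
    fun g p => A.normalize_smul g (h₀ p) (h₁ p) (h₂ p) (h₀ _) (h₁ _) (h₂ _) ?_,
    fun p i h => ha p i (hz p i h)⟩
  · have hs : ∀ p : EuclideanSimplex (nerve A.sets) σ, ∀ i ∉ σ, a p.incl i = 0 := fun p i hi =>
      by_contra fun h => (ha _ i h).2 (p.eq_zero hi)
    have hc : ∀ i, Continuous fun p : EuclideanSimplex (nerve A.sets) σ => a p.incl i := fun i =>
      ((continuous_const.mul (EuclideanSimplex.continuous_coord i)).sub
        (continuous_iSup_of_locallyFinite EuclideanSimplex.continuous_coord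
          (locallyFinite_support_of_forall fun p i hi => p.eq_zero hi)
          fun p => p.incl.2.1)).max continuous_const
    refine continuous_of_locallyFinite_coord (Realization.continuous_normalize hc
      (locallyFinite_support_of_forall hs) _ _ _)
      (locallyFinite_support_of_forall (σ := σ) fun p i hi => ?_)
    exact by_contra fun h => hz _ i h (hs p i hi)
  · funext i
    simp only [a, A.smul_coord, iSup_smul]

variable [TopologicalSpace X]

theorem InvariantCover.IsEquivalentRefinement.subset {A B : InvariantCover G ι X}
    (h : A.IsEquivalentRefinement B) (i : ι) : A.sets i ⊆ B.sets i := by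
  intro x hx
  obtain ⟨S, hS, hAS, -⟩ := h.1 {i} ⟨Finset.singleton_nonempty i, x, by simpa [inter] using hx⟩
  have : x ∈ inter B.sets {i} := hS ▸ hAS (by simpa [inter] using hx)
  simpa [inter] using this

variable [T2Space X] [ParacompactSpace X] [ContinuousConstSMul G X]

theorem gHomotopyEquivalent_nerve (A U : InvariantCover G ι X)
    (hcl : ∀ i, IsClosed (A.sets i)) (hfin : LocallyFinite A.sets)
    (hU : ∀ i, IsOpen (U.sets i)) (href : A.IsEquivalentRefinement U)
    (hstab : ∀ σ ∈ (nerve A.sets).faces, Finite (stab G A.sets σ))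
    (hcontr : ∀ σ ∈ (nerve A.sets).faces,
      GContractible (stab G A.sets σ) (interSub G A.sets σ)) :
    GHomotopyEquivalent G X (Realization (nerve A.sets)) := by
  classical
  obtain ⟨φ, S, hφc, hφ₀, hφpos, hφe, hSf, hScl, hSU, hφS⟩ := A.exists_equivariant_bump U hcl hfin
    hU href.subset (A.finite_stabilizer hstab)
  obtain ⟨c, hc, hce⟩ := exists_equivariant_contraction A U href hcontr
  obtain ⟨θ, hθe, hθ⟩ := exists_push_to_large A
  have hF := inter_antitone U.sets
  have hface : ∀ σ : Finset ι, σ.Nonempty → (inter U.sets σ).Nonempty →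
      σ ∈ (nerve A.sets).faces := fun σ h₁ h₂ => by rw [href.2]; exact ⟨h₁, h₂⟩
  have hK : ∀ σ ∈ (nerve A.sets).faces, (inter U.sets σ).Nonempty := fun σ hσ => by
    rw [href.2] at hσ; exact hσ.2
  -- the map to the nerve
  have hφf : LocallyFinite fun i => support fun x => φ i x := hSf.subset fun i x hx => hφS i x hx
  have h₁ : ∀ x, ∃ σ ∈ (nerve A.sets).faces, ∀ i ∉ σ, φ i x = 0 := fun x => by
    have hx : (support fun i => φ i x).Finite := hφf.point_finite x
    obtain ⟨i, hi⟩ := hφpos x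
    refine ⟨hx.toFinset, hface _ ⟨i, by simpa using hi.ne'⟩ ⟨x, mem_inter.2 fun j hj =>
      hSU j (hφS j x (by simpa using hj))⟩, fun j hj => by simpa using hj⟩
  let F : X → Realization (nerve A.sets) := fun x =>
    Realization.normalize _ (fun i => φ i x) (fun i => hφ₀ i x) (h₁ x) (hφpos x)
  have hFS : ∀ x i, (F x).1 i ≠ 0 → x ∈ S i := fun x i h =>
    hφS i x (mt (Realization.normalize_eq_zero_iff (fun i => hφ₀ i x) (h₁ x) (hφpos x) i).2 h)
  have hFU : ∀ x i, (F x).1 i ≠ 0 → x ∈ U.sets i := fun x i h => hSU i (hFS x i h)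
  have hFcoord : ∀ i, Continuous fun x => (F x).1 i :=
    Realization.continuous_normalize hφc hφf _ _ _
  have hFf : LocallyFinite fun i => support fun x => (F x).1 i := hSf.subset fun i x => hFS x i
  have hFe : ∀ (g : G) x, F (g • x) = g • F x := fun g x =>
    A.normalize_smul g _ _ _ _ _ _ <| funext fun i => by rw [← hφe g (g⁻¹ • i), smul_inv_smul]
  let f : C(X, Realization (nerve A.sets)) := ⟨F, continuous_of_locallyFinite_coord hFcoord hFf⟩
  -- the map from the nerve
  let h : C(Realization (nerve A.sets), X) := ⟨nerveMap c hK, continuous_nerveMap hF hc hK⟩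
  have hhe : ∀ (g : G) p, h (g • p) = g • h p := fun g p => by
    change nerveMap c hK (g • p) = g • totalFlow c _ 0 _
    obtain ⟨hσ, hσs⟩ := p.exists_face_support.choose_spec
    rw [← totalFlow_smul hce (finite_support_cap p.finite_support), ← cap_smul, ← A.smul_coord]
    refine nerveMap_eq hF hc hK _ fun τ _ hτ => mem_inter.2 fun i hi => ?_
    rw [← smul_inv_smul g i, U.smul_mem_iff]
    exact mem_inter.1 (hK _ hσ).choose_spec _ ((hσs _).2 (hτ i hi))
  have hhU : ∀ p i, ⨆ j, p.1 j ≤ 2 * p.1 i → h p ∈ U.sets i := fun p i hi => by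
    have := nerveMap_mem hF hc hK p (τ := {i}) (by simpa using hi)
    exact mem_inter.1 this i (Finset.mem_singleton_self i)
  refine ⟨f, h, hFe, hhe, ?_, ?_⟩
  · have hcapc : ∀ i, Continuous fun z : I × X => cap (F z.2).1 i := fun i =>
      (continuous_cap hFcoord hFf (fun x => (F x).2.1) (fun x => (F x).exists_pos) i).comp
        (continuous_snd (X := I) (Y := X))
    have hcap : ∀ x i, cap (F x).1 i ≠ 0 → x ∈ S i := fun x i hx =>
      hFS x i fun h' => hx (cap_eq_zero h')
    have hSF : ∀ x (τ : Finset ι), (∀ i ∈ τ, x ∈ S i) → x ∈ inter U.sets τ := fun x τ hx =>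
      mem_inter.2 fun i hi => hSU i (hx i hi)
    refine ⟨⟨⟨fun z => totalFlow c (cap (F z.2).1) z.1 z.2, ?_⟩, fun x => ?_, fun x => ?_⟩,
      fun g t x => ?_⟩
    · refine continuous_iff_continuousAt.2 fun z => ?_
      -- The step count depends on `z`, but near `z₀` no new `S i` are met, so the count at `z₀`
      -- serves there.
      have hcont : Continuous fun z : I × X =>
          cutFlow c (cap (F z.2).1) z.1 (hSf.point_finite z.2).toFinset.card z.2 := by
        refine continuous_iff_continuousAt.2 fun z₀ => ?_
        have := continuous_cutFlow (S := fun i => (Prod.snd ⁻¹' S i : Set (I × X)))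
          (p := fun z => cap (F z.2).1) (s := Prod.fst) (m := Prod.snd) hF hc
          (hSf.preimage_continuous continuous_snd) (fun i => (hScl i).preimage continuous_snd)
          (fun z => cap_nonneg (F z.2).2.1) (fun z => hcap z.2)
          hcapc continuous_fst continuous_snd
          (hSf.point_finite z₀.2).toFinset.card fun z τ _ _ hτ _ => hSF z.2 τ hτ
        refine this.continuousAt.congr ?_
        have hev : ∀ᶠ z : I × X in 𝓝 z₀, ∀ i, z.2 ∈ S i → z₀.2 ∈ S i := by
          filter_upwards [continuous_snd.continuousAt (hSf.iInter_compl_mem_nhds hScl z₀.2)]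
            with z hz i hi
          by_contra h
          exact (Set.mem_iInter₂.1 hz i h) hi
        filter_upwards [hev] with z hz
        refine cutFlow_eq_of_le (cap_nonneg (F z.2).2.1) (fun i hi => ?_)
          (Finset.card_le_card fun i hi => ?_) _
        · exact by_contra fun h' => hi (by simpa using hcap z.2 i h')
        · simpa using hz i (by simpa using hi)
      refine hcont.continuousAt.congr (Filter.Eventually.of_forall fun z => ?_)
      exact (totalFlow_eq (cap_nonneg (F z.2).2.1)
        (fun i hi => by_contra fun h' => hi (by simpa using hcap z.2 i h')) _).symm
    -- The point `x` is itself an admissible start for the flow that computes `h (f x)`.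
    · exact (nerveMap_eq hF hc hK (F x) fun τ _ hτ =>
        hSF x τ fun i hi => hFS x i (hτ i hi)).symm
    · refine cutFlow_one hc (finite_support_cap (F x).finite_support) fun τ _ _ hτ =>
        hSF x τ fun i hi => hFS x i (isCut_cap_ne_zero (F x).2.1 hτ hi)
    · change totalFlow c (cap (F (g • x)).1) t (g • x) = g • totalFlow c (cap (F x).1) t x
      rw [← totalFlow_smul hce (finite_support_cap (F x).finite_support), hFe, A.smul_coord,
        cap_smul]
  · have hG : ∀ (g : G) (p q : Realization (nerve A.sets)) (t : I) h h',
      Realization.lineMap t (g • p) (g • q) h' = g • Realization.lineMap t p q h :=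
      fun _ _ _ _ _ _ => rfl
    have hθf : ∀ σ ∈ (nerve A.sets).faces, LocallyFinite fun i =>
        support fun p : EuclideanSimplex (nerve A.sets) σ => (θ p.incl).1 i := fun σ _ =>
      locallyFinite_support_of_forall fun p i hi =>
        by_contra fun h => (hθ _ i h).2 (p.eq_zero hi)
    refine GHomotopic.trans (f₁ := θ) ?_ ?_
    · refine gHomotopic_of_mem_face hG _ _ (fun g p => ?_) hθe (fun σ hσ => ?_) hθf fun p => ?_
      · exact (congrArg F (hhe g p)).trans (hFe g _)
      · exact hFf.preimage_continuous
          (h.continuous.comp (continuous_realization_iff.1 continuous_id σ hσ))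
      -- The point `h p` lies in `U.sets i` for every vertex `i` of either support, so it witnesses
      -- that their union is a simplex.
      · let τ := (F (h p)).finite_support.toFinset ∪ (θ p).finite_support.toFinset
        have hτ : ∀ i, i ∈ τ ↔ (F (h p)).1 i ≠ 0 ∨ (θ p).1 i ≠ 0 := fun i => by simp [τ]
        obtain ⟨i, hi⟩ := (θ p).exists_pos
        refine ⟨τ, hface τ ⟨i, (hτ i).2 (Or.inr hi.ne')⟩ ⟨h p, mem_inter.2 fun j hj => ?_⟩,
          fun j hj => ?_⟩
        · rcases (hτ j).1 hj with hj | hj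
          · exact hFU _ j hj
          · exact hhU p j (hθ p j hj).1
        · rw [hτ, not_or, not_not, not_not] at hj
          exact hj
    · refine gHomotopic_of_mem_face hG _ _ hθe (fun _ _ => rfl) hθf (fun σ _ => ?_) fun p => ?_
      · exact locallyFinite_support_of_forall fun p i hi => p.eq_zero hi
      · obtain ⟨σ, hσ, hs⟩ := p.exists_face_support
        refine ⟨σ, hσ, fun i hi => ?_⟩
        have hi' : p.1 i = 0 := by_contra fun h => hi ((hs i).2 h)
        exact ⟨by_contra fun h => (hθ p i h).2 hi', hi'⟩

end Main

end EquivariantNerve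

theorem mainTheorem5 {G ι X : Type*} [Group G] [TopologicalSpace X] [T2Space X]
    [ParacompactSpace X] [MulAction G X] [ContinuousConstSMul G X] [ProperlyDiscontinuousSMul G X]
    [MulAction G ι] (𝒜 𝒰 : EquivariantNerve.InvariantCover G ι X)
    (h𝒜_closed : ∀ i, IsClosed (𝒜.sets i)) (h𝒜_fin : LocallyFinite 𝒜.sets)
    (h𝒰_open : ∀ i, IsOpen (𝒰.sets i)) (href : 𝒜.IsEquivalentRefinement 𝒰)
    (hstab : ∀ σ ∈ (EquivariantNerve.nerve 𝒜.sets).faces,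
      Finite (EquivariantNerve.stab G 𝒜.sets σ))
    (hcontr : ∀ σ ∈ (EquivariantNerve.nerve 𝒜.sets).faces,
      EquivariantNerve.GContractible (EquivariantNerve.stab G 𝒜.sets σ)
        (EquivariantNerve.interSub G 𝒜.sets σ)) :
    EquivariantNerve.GHomotopyEquivalent G X
      (EquivariantNerve.Realization (EquivariantNerve.nerve 𝒜.sets)) :=
  EquivariantNerve.gHomotopyEquivalent_nerve 𝒜 𝒰 h𝒜_closed h𝒜_fin h𝒰_open href hstab hcontr
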